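/- An alternating quantum-classical circuit on a grid of qubits consists of $d$ rounds. In each round, (i) a classical Boolean circuit computes control bits from the outcomes of the earlier measurements; (ii) a quantum circuit is applied that consists of arbitrary single-qubit unitaries and of CNOT gates between directly neighbouring qubits of the grid, where each gate may be applied conditionally on one of the control bits; (iii) a subset of the qubits is measured in the computational basis. A family $(A_n)$ of such circuits is an $\mathsf{LAQCC}=\mathsf{LAQCC}(\mathsf{QNC}^0,\mathsf{NC}^1,O(1))$ family if the number of rounds and the depth of all quantum circuits are bounded by constants independent of $n$, and the classical circuits are $\mathsf{NC}^1$-circuits, that is, they use AND- and OR-gates of fan-in two and NOT-gates and have depth $O(\log n)$ and size polynomial in $n$. (No uniformity of the family is required.) The circuit $A_n$ prepares an $n$-qubit state $|\psi\rangle$ if, when it is started with all qubits in $|0\rangle$, for every sequence of measurement outcomes that occurs with nonzero probability the final state is, up to a global phase, $|\psi\rangle$ on $n$ fixed qubits of the grid and $|0\rangle$ on all other qubits. Theorem. There is an $\mathsf{LAQCC}$ family of circuits $(A_n)$ such that, for every $n\ge 1$, $A_n$ prepares the $n$-qubit $W$-state $$|W\rangle=\frac{1}{\sqrt n}\sum_{i=1}^{n}|e_i\rangle,$$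 where $|e_i\rangle$ is the computational basis state with a one at position $i$ and zeros elsewhere. The circuit $A_n$ uses $O(n\log n\log\log n)$ qubits, placed in a grid of size $n\times O(\log n\log\log n)$. -/

import Mathlib

open Filter Asymptotics

/-! ### Classical (conventional) circuits -/

/-- Boolean circuits with one output and gates AND, OR (fan-in two), NOT, in which every gate has
fan-out one. A fan-in-two circuit of logarithmic depth unfolds, output bit by output bit, into such
formulas of logarithmic depth and polynomial size, so these describe `NC¹`. -/
inductive BoolFormula (α : Type) : Type
  | var (a : α) : BoolFormula α
  | const (b : Bool) : BoolFormula α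
  | not (f : BoolFormula α) : BoolFormula α
  | and (f g : BoolFormula α) : BoolFormula α
  | or (f g : BoolFormula α) : BoolFormula α

namespace BoolFormula

/-- The value of the output bit on the input `v`. -/
def eval {α : Type} (v : α → Bool) : BoolFormula α → Bool
  | var a => v a
  | const b => b
  | not f => !(f.eval v)
  | and f g => f.eval v && g.eval v
  | or f g => f.eval v || g.eval v

/-- The largest number of gates on a path from an input to the output. -/
def depth {α : Type} : BoolFormula α → ℕ
  | var _ => 0
  | const _ => 0
  | not f => f.depth + 1
  | and f g => max f.depth g.depth + 1
  | or f g => max f.depth g.depth + 1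

/-- The number of gates and leaves. -/
def size {α : Type} : BoolFormula α → ℕ
  | var _ => 1
  | const _ => 1
  | not f => f.size + 1
  | and f g => f.size + g.size + 1
  | or f g => f.size + g.size + 1

end BoolFormula

/-! ### Quantum states and gates -/

/-- Vectors of the Hilbert space `(ℂ²)^{⊗ Q}` of a set `Q` of qubits, given by their amplitudes
in the computational basis. They need not be normalized. -/
abbrev QState (Q : Type) : Type := (Q → Bool) → ℂ

/-- The computational basis state `|y⟩`. -/
noncomputable def ket {Q : Type} (y : Q → Bool) : QState Q :=
  open Classical in fun x => if x = y then 1 else 0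

/-- Gates on the qubits `Q` with connectivity graph `G`: all single-qubit unitaries, and CNOT
gates between neighbouring qubits. -/
inductive QGate {Q : Type} (G : SimpleGraph Q) : Type
  | single (q : Q) (U : Matrix.unitaryGroup Bool ℂ) : QGate G
  | cnot (control target : Q) (h : G.Adj control target) : QGate G

namespace QGate

variable {Q : Type} [DecidableEq Q] {G : SimpleGraph Q}

/-- The qubits on which a gate acts. -/
def support : QGate G → Finset Q
  | single q _ => {q}
  | cnot a b _ => {a, b}

/-- The action of a gate on states. -/
noncomputable def apply : QGate G → QState Q → QState Q
  | single q U, ψ => fun x => ∑ b : Bool, U.1 (x q) b * ψ (Function.update x q b)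
  | cnot a b _, ψ => fun x => ψ (Function.update x b (xor (x b) (x a)))

end QGate

/-- A gate that is either applied unconditionally (`ctrl = none`), or applied if and only if one of
`k` classical control bits equals one. -/
structure ControlledQGate {Q : Type} (G : SimpleGraph Q) (k : ℕ) where
  gate : QGate G
  ctrl : Option (Fin k)

/-- The action of a classically controlled gate, given the control bits `y`. -/
noncomputable def ControlledQGate.apply {Q : Type} [DecidableEq Q] {G : SimpleGraph Q} {k : ℕ}
    (g : ControlledQGate G k) (y : Fin k → Bool) (ψ : QState Q) : QState Q :=
  match g.ctrl with
  | none => g.gate.apply ψ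
  | some j => if y j then g.gate.apply ψ else ψ

/-- A depth-one quantum circuit: gates that act on pairwise disjoint sets of qubits. -/
structure DepthOneLayer {Q : Type} [DecidableEq Q] (G : SimpleGraph Q) (k : ℕ) where
  gates : List (ControlledQGate G k)
  disjoint : gates.Pairwise fun g g' => Disjoint g.gate.support g'.gate.support

/-- The action of a depth-one circuit (the order of the gates does not matter, as they are
disjoint). -/
noncomputable def DepthOneLayer.apply {Q : Type} [DecidableEq Q] {G : SimpleGraph Q} {k : ℕ}
    (L : DepthOneLayer G k) (y : Fin k → Bool) (ψ : QState Q) : QState Q :=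
  L.gates.foldl (fun φ g => g.apply y φ) ψ

/-! ### Alternating quantum-classical circuits -/

/-- One round `M U C` of an alternating circuit. First a classical circuit `C` computes `bits`
control bits from the outcomes of the earlier measurements: its input variable `(j, q)` is the
outcome for the qubit `q` in the measurement made `j + 1` rounds ago. Then a quantum circuit `U`
is applied, given as a list of depth-one circuits whose gates may be controlled by these bits.
Finally the qubits in `measured` are measured in the computational basis. -/
structure HybridRound {Q : Type} [DecidableEq Q] (G : SimpleGraph Q) where
  bits : ℕ
  classical : Fin bits → BoolFormula (ℕ × Q)
  quantum : List (DepthOneLayer G bits)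
  measured : Finset Q

namespace HybridRound

variable {Q : Type} [DecidableEq Q] {G : SimpleGraph Q}

/-- The quantum circuit of the round, given the record `r` of the earlier outcomes. -/
noncomputable def applyQuantum (R : HybridRound G) (r : ℕ × Q → Bool) (ψ : QState Q) : QState Q :=
  R.quantum.foldl (fun φ L => L.apply (fun i => (R.classical i).eval r) φ) ψ

/-- The projection onto the outcome `o` of the measurement. The result is not normalized, so that
its squared norm is the probability of the outcome (times the squared norm of `ψ`). -/
noncomputable def project (R : HybridRound G) (o : R.measured → Bool) (ψ : QState Q) : QState Q :=
  fun x => if ∀ q : R.measured, x q = o q then ψ x else 0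

/-- The record after the round: the new outcomes are put in front of the old ones. Entries that do
not belong to a measurement read `false`. -/
def pushRecord (R : HybridRound G) (o : R.measured → Bool) (r : ℕ × Q → Bool) : ℕ × Q → Bool
  | (0, q) => if h : q ∈ R.measured then o ⟨q, h⟩ else false
  | (j + 1, q) => r (j, q)

end HybridRound

/-- An alternating circuit is a sequence of rounds. -/
abbrev HybridCircuit {Q : Type} [DecidableEq Q] (G : SimpleGraph Q) : Type :=
  List (HybridRound G)

namespace HybridCircuit

variable {Q : Type} [DecidableEq Q] {G : SimpleGraph Q}

/-- The unnormalized final states of all branches (one for each sequence of measurement outcomes),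
when the circuit is run from the state `ψ` and the record `r`. The squared norm of a final state is
the probability of its branch; the branches of probability zero contribute the zero vector. -/
def branches : HybridCircuit G → (ℕ × Q → Bool) → QState Q → Set (QState Q)
  | [], _, ψ => {ψ}
  | R :: A, r, ψ =>
      ⋃ o : R.measured → Bool, branches A (R.pushRecord o r) (R.project o (R.applyQuantum r ψ))

/-- The state of all the qubits `Q` that is `ψ` on the qubits selected by `out` and `|0⟩` on all
the others. -/
noncomputable def embedState {m : ℕ} (out : Fin m ↪ Q) (ψ : QState (Fin m)) : QState Q :=
  open Classical in fun x => if ∀ q, q ∉ Set.range out → x q = false then ψ (x ∘ out) else 0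

/-- The circuit, started with all qubits in `|0⟩`, deterministically prepares `ψ` on the qubits
selected by `out`: whatever the measurement outcomes, the final state is `ψ` on these qubits and
`|0⟩` on all the others, up to a scalar (the global phase times the square root of the probability
of the branch). -/
def Prepares {m : ℕ} (A : HybridCircuit G) (out : Fin m ↪ Q) (ψ : QState (Fin m)) : Prop :=
  ∀ φ ∈ branches A (fun _ => false) (ket fun _ => false), ∃ c : ℂ, φ = c • embedState out ψ

end HybridCircuit

/-- The grid with `m` rows and `w` columns, in which the direct neighbours are adjacent. -/
abbrev gridGraph (m w : ℕ) : SimpleGraph (Fin m × Fin w) :=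
  (SimpleGraph.pathGraph m).boxProd (SimpleGraph.pathGraph w)

/-- A family of circuits, with the `n`-th one on a grid of `rows n × cols n` qubits, belongs to
`LAQCC = LAQCC(QNC⁰, NC¹, O(1))`: the number of rounds is bounded by a constant, the depth of
every quantum circuit is bounded by a constant, and the classical circuits have depth `O(log n)`
and size polynomial in `n`. -/
structure IsLAQCC {rows cols : ℕ → ℕ}
    (A : (n : ℕ) → HybridCircuit (gridGraph (rows n) (cols n))) : Prop where
  rounds : ∃ d : ℕ, ∀ n, (A n).length ≤ d
  quantum_depth : ∃ D : ℕ, ∀ n, ∀ R ∈ A n, R.quantum.length ≤ D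
  classical_depth : ∃ c : ℕ, ∀ n, ∀ R ∈ A n, ∀ i, (R.classical i).depth ≤ c * (Nat.log 2 n + 1)
  classical_size : ∃ c : ℕ, ∀ n, ∀ R ∈ A n, ∑ i, (R.classical i).size ≤ (n + 1) ^ c

/-- The state `|W⟩ = n^{-1/2} ∑ᵢ |eᵢ⟩` on `n` qubits. -/
noncomputable def wState (n : ℕ) : QState (Fin n) :=
  ((1 / Real.sqrt n : ℝ) : ℂ) • ∑ i : Fin n, ket fun j => decide (j = i)

set_option linter.unusedSectionVars false

/-! ### Parities and formulas for them -/

/-! The construction is amplitude amplification that succeeds with certainty. If every data qubit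
carries a one with probability `p`, where `n p (1 - p)^(n-1) = 1/4` (`exists_prob`), the weight-one
part of the product state has norm `1/2 = sin (π/6)`. One Grover step triples the angle to `π/2` and
leaves exactly the W-state (`amplify`). It needs phase flips that single out the strings of weight
one and of weight zero, so everything reduces to such flips for a given weight `t` in constant
depth.

`Grid.realizes_weight` provides them, with `m + 1` auxiliary qubits where `2^m ≤ n < 2^(m+1)`.
Auxiliary qubit `j` acquires the relative phase `exp (iπ(|x| - t)/2^j)`. After Hadamard gates the
register is exactly zero if `|x| = t`. Otherwise it is orthogonal to zero: writing `|x| - t = 2^k ·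
odd`, the phase of qubit `k` is `-1`. A sign on the nonzero strings, followed by the inverse
transformation, therefore acts without error. That sign is a product of phases `π/2^m` over all
parities of the auxiliary bits, because a nonzero string has odd parity on exactly half of the
`2^(m+1)` subsets (`prod_phase_parity`).

What remains are single-qubit phases on qubits that hold parities of register bits. Measurement
makes such qubits in constant depth (`IsEncoder.exists_phase_circuit`): ancillas start in `|+⟩`,
check qubits measure the defining parity relations, and bit flips repair the relations that came out
wrong. After the phases the ancillas are measured in the Hadamard basis, and sign flips on the data
remove the resulting byproduct. The classical work consists of parities of outcomes only, which have
formulas of logarithmic depth. On the grid, `Grid.encodeMap` copies the auxiliary bits down the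
columns and passes running sums along the rows. Its width is `O(log n)`, below the bound that is
claimed. -/

instance xor_commutative : Std.Commutative xor := ⟨Bool.xor_comm⟩

instance xor_associative : Std.Associative xor := ⟨Bool.xor_assoc⟩

/-- The parity of the bits of `x` at the positions in `S`. -/
def parity {Q : Type} (S : Finset Q) (x : Q → Bool) : Bool := S.fold xor false x

/-- The sign `(-1)^b`. -/
noncomputable def bsign (b : Bool) : ℂ := if b then -1 else 1

@[simp] theorem bsign_true : bsign true = -1 := rfl
@[simp] theorem bsign_false : bsign false = 1 := rfl

theorem bsign_xor (a b : Bool) : bsign (xor a b) = bsign a * bsign b := by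
  cases a <;> cases b <;> simp

theorem bsign_mul_self (a : Bool) : bsign a * bsign a = 1 := by cases a <;> simp

theorem bsign_injective : Function.Injective bsign := by
  have h1 : (-1 : ℂ) ≠ 1 := by norm_num
  rintro (_ | _) (_ | _) h
  · rfl
  · exact absurd h.symm h1
  · exact absurd h h1
  · rfl

section parity

variable {Q : Type}

@[simp] theorem parity_empty (x : Q → Bool) : parity ∅ x = false := rfl

@[simp] theorem parity_singleton (q : Q) (x : Q → Bool) : parity {q} x = x q := by
  simp [parity]

theorem bsign_parity (S : Finset Q) (x : Q → Bool) :
    bsign (parity S x) = ∏ q ∈ S, bsign (x q) := by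
  classical
  induction S using Finset.induction_on with
  | empty => simp
  | insert a S ha ih =>
    rw [Finset.prod_insert ha, ← ih, ← bsign_xor]
    simp [parity, ha]

theorem parity_union [DecidableEq Q] {S T : Finset Q} (h : Disjoint S T) (x : Q → Bool) :
    parity (S ∪ T) x = xor (parity S x) (parity T x) := by
  apply bsign_injective
  rw [bsign_xor]
  simp only [bsign_parity]
  exact Finset.prod_union h

theorem parity_symmDiff [DecidableEq Q] (S T : Finset Q) (x : Q → Bool) :
    parity (symmDiff S T) x = xor (parity S x) (parity T x) := by
  have h1 : S = (S \ T) ∪ (S ∩ T) := (Finset.sdiff_union_inter S T).symm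
  have h2 : T = (T \ S) ∪ (S ∩ T) := by rw [Finset.inter_comm, Finset.sdiff_union_inter]
  have d1 : Disjoint (S \ T) (S ∩ T) := Finset.disjoint_sdiff_inter S T
  have d2 : Disjoint (T \ S) (S ∩ T) := by
    rw [Finset.inter_comm]; exact Finset.disjoint_sdiff_inter T S
  have d3 : Disjoint (S \ T) (T \ S) := disjoint_sdiff_sdiff
  have e1 := parity_union d1 x
  have e2 := parity_union d2 x
  rw [← h1] at e1
  rw [← h2] at e2
  have e3 : parity (symmDiff S T) x = xor (parity (S \ T) x) (parity (T \ S) x) :=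
    parity_union d3 x
  rw [e1, e2, e3]
  cases parity (S \ T) x <;> cases parity (T \ S) x <;> cases parity (S ∩ T) x <;> rfl

theorem parity_congr {S : Finset Q} {x y : Q → Bool} (h : ∀ q ∈ S, x q = y q) :
    parity S x = parity S y := by
  apply bsign_injective
  simp only [bsign_parity]
  exact Finset.prod_congr rfl fun q hq => by rw [h q hq]

/-- Exchanging the order of summation in `∑_a t_a ∑_{d ∈ S_a} x_d`, written with signs. -/
theorem prod_bsign_and_parity {α : Type} [Fintype α] [Fintype Q] [DecidableEq Q]
    (S : α → Finset Q) (t : α → Bool) (x : Q → Bool) :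
    ∏ a, bsign (t a && parity (S a) x) =
      ∏ q, bsign (x q && parity (Finset.univ.filter fun a => q ∈ S a) t) := by
  have h1 : ∀ a, bsign (t a && parity (S a) x) =
      ∏ q, if q ∈ S a then bsign (t a && x q) else 1 := by
    intro a
    rw [← Finset.prod_filter, Finset.filter_mem_eq_inter, Finset.univ_inter]
    cases h : t a
    · simp
    · simp [bsign_parity]
  have h2 : ∀ q, bsign (x q && parity (Finset.univ.filter fun a => q ∈ S a) t) =
      ∏ a, if q ∈ S a then bsign (t a && x q) else 1 := by
    intro q
    rw [← Finset.prod_filter]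
    cases h : x q
    · simp
    · simp [bsign_parity]
  simp only [h1, h2]
  exact Finset.prod_comm

end parity

namespace BoolFormula

variable {α : Type}

/-- Exclusive or, written with AND, OR and NOT. -/
def xor' (f g : BoolFormula α) : BoolFormula α := or (and f (not g)) (and (not f) g)

theorem eval_xor' (v : α → Bool) (f g : BoolFormula α) :
    (xor' f g).eval v = xor (f.eval v) (g.eval v) := by
  simp only [xor', eval]
  cases f.eval v <;> cases g.eval v <;> rfl

theorem depth_xor' (f g : BoolFormula α) : (xor' f g).depth ≤ max f.depth g.depth + 3 := by
  simp only [xor', depth]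
  omega

/-- Formulas are binary trees, so logarithmic depth already forces polynomial size. -/
theorem size_lt_two_pow (f : BoolFormula α) : f.size < 2 ^ (f.depth + 1) := by
  induction f with
  | var a => simp [size, depth]
  | const b => simp [size, depth]
  | not f ih =>
    simp only [size, depth]
    rw [pow_succ]
    have := Nat.one_le_two_pow (n := f.depth + 1)
    omega
  | and f g ihf ihg | or f g ihf ihg =>
    simp only [size, depth]
    have h1 : 2 ^ (f.depth + 1) ≤ 2 ^ (max f.depth g.depth + 1) :=
      Nat.pow_le_pow_right (by norm_num) (by omega)
    have h2 : 2 ^ (g.depth + 1) ≤ 2 ^ (max f.depth g.depth + 1) :=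
      Nat.pow_le_pow_right (by norm_num) (by omega)
    rw [pow_succ 2 (max f.depth g.depth + 1)]
    omega

/-- The parity of `2 ^ k` bits has a formula of depth `3 k`. -/
theorem exists_eval_eq_parity {Q : Type} (u : Q → α) (k : ℕ) (S : Finset Q) (hS : S.card ≤ 2 ^ k) :
    ∃ f : BoolFormula α, f.depth ≤ 3 * k ∧ ∀ v, f.eval v = parity S fun q => v (u q) := by
  classical
  induction k generalizing S with
  | zero =>
    rcases S.eq_empty_or_nonempty with rfl | hne
    · exact ⟨const false, by simp [depth], fun v => by simp [eval]⟩
    · obtain ⟨q, rfl⟩ := Finset.card_eq_one.1 (le_antisymm hS hne.card_pos)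
      exact ⟨var (u q), by simp [depth], fun v => by simp [eval]⟩
  | succ k ih =>
    -- Split off `2 ^ k` elements, or all of `S` if there are fewer; both parts then obey the
    -- induction hypothesis, and joining them by `xor'` costs three levels.
    obtain ⟨T, hT, hc⟩ := Finset.exists_subset_card_eq (s := S) (n := min S.card (2 ^ k)) (by omega)
    obtain ⟨f, hf, hf'⟩ := ih T (by omega)
    obtain ⟨g, hg, hg'⟩ := ih (S \ T) (by
      rw [Finset.card_sdiff_of_subset hT, hc]
      rw [pow_succ] at hS
      omega)
    refine ⟨xor' f g, (depth_xor' f g).trans (by omega), fun v => ?_⟩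
    rw [eval_xor', hf', hg', ← parity_union Finset.disjoint_sdiff, Finset.union_sdiff_of_subset hT]

end BoolFormula

/-! ### Tensor products of single-qubit operators -/

section tens

variable {Q : Type} [Fintype Q] [DecidableEq Q]

/-- The tensor product of the single-qubit operators `W q`. -/
noncomputable def tens (W : Q → Matrix Bool Bool ℂ) (ψ : QState Q) : QState Q :=
  fun x => ∑ y, (∏ q, W q (x q) (y q)) * ψ y

theorem tens_smul (W : Q → Matrix Bool Bool ℂ) (c : ℂ) (ψ : QState Q) :
    tens W (c • ψ) = c • tens W ψ := by
  funext x
  simp only [tens, Pi.smul_apply, smul_eq_mul, Finset.mul_sum]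
  exact Finset.sum_congr rfl fun y _ => by ring

theorem tens_tens (W W' : Q → Matrix Bool Bool ℂ) (ψ : QState Q) :
    tens W (tens W' ψ) = tens (fun q => W q * W' q) ψ := by
  funext x
  simp only [tens, Matrix.mul_apply, Finset.mul_sum]
  rw [Finset.sum_comm]
  refine Finset.sum_congr rfl fun z _ => ?_
  rw [Finset.prod_univ_sum, Fintype.piFinset_univ, Finset.sum_mul]
  refine Finset.sum_congr rfl fun y _ => ?_
  rw [Finset.prod_mul_distrib]
  ring

/-- If `ψ` vanishes on all but one of the strings that contribute, a single term remains. -/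
theorem tens_eq_single (W : Q → Matrix Bool Bool ℂ) (ψ : QState Q) (x y : Q → Bool)
    (h : ∀ z, z ≠ y → (∃ q, W q (x q) (z q) = 0) ∨ ψ z = 0) :
    tens W ψ x = (∏ q, W q (x q) (y q)) * ψ y := by
  refine Finset.sum_eq_single y (fun z _ hz => ?_) (fun h => absurd (Finset.mem_univ _) h)
  rcases h z hz with ⟨q, hq⟩ | h
  · rw [Finset.prod_eq_zero (Finset.mem_univ q) hq, zero_mul]
  · rw [h, mul_zero]

theorem tens_diagonal (d : Q → Bool → ℂ) (ψ : QState Q) :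
    tens (fun q => Matrix.diagonal (d q)) ψ = fun x => (∏ q, d q (x q)) * ψ x := by
  funext x
  rw [tens_eq_single _ _ x x]
  · simp
  · intro z hz
    obtain ⟨q, hq⟩ := Function.ne_iff.1 hz
    exact Or.inl ⟨q, Matrix.diagonal_apply_ne _ (Ne.symm hq)⟩

theorem tens_one (ψ : QState Q) : tens (fun _ => 1) ψ = ψ := by
  have := tens_diagonal (fun (_ : Q) _ => 1) ψ
  simpa using this

/-- An operator that acts as the identity outside the range of `act`. -/
theorem tens_apply_of_injective {ι : Type} [Fintype ι] [DecidableEq ι] {act : ι → Q}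
    (hact : Function.Injective act) (W : Q → Matrix Bool Bool ℂ)
    (hW : ∀ q, q ∉ Set.range act → W q = 1) (ψ : QState Q) (x : Q → Bool) :
    tens W ψ x = ∑ y : ι → Bool,
      (∏ i, W (act i) (x (act i)) (y i)) * ψ (Function.extend act y x) := by
  classical
  symm
  refine Fintype.sum_of_injective (fun y => Function.extend act y x) ?_ _ _ ?_ ?_
  · intro y y' h
    funext i
    have := congrFun h (act i)
    simpa [hact.extend_apply] using this
  · intro z hz
    have : ∃ q, q ∉ Set.range act ∧ z q ≠ x q := by
      by_contra! hc
      refine hz ⟨fun i => z (act i), ?_⟩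
      funext q
      by_cases hq : q ∈ Set.range act
      · obtain ⟨i, rfl⟩ := hq
        simp only [hact.extend_apply]
      · simp only [Function.extend_apply' _ _ _ hq, hc q hq]
    obtain ⟨q, hq, hzq⟩ := this
    rw [Finset.prod_eq_zero (Finset.mem_univ q), zero_mul]
    rw [hW q hq, Matrix.one_apply_ne (Ne.symm hzq)]
  · intro y
    congr 1
    refine Fintype.prod_of_injective act hact _ _ ?_ ?_
    · intro q hq
      rw [Function.extend_apply' _ _ _ hq, hW q hq, Matrix.one_apply_eq]
    · intro i
      rw [hact.extend_apply]

/-- The operator `M` on the qubit `q`. -/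
theorem tens_update (q : Q) (M : Matrix Bool Bool ℂ) (ψ : QState Q) (x : Q → Bool) :
    tens (Function.update (fun _ => 1) q M) ψ x =
      ∑ b : Bool, M (x q) b * ψ (Function.update x q b) := by
  have hinj : Function.Injective (fun _ : Unit => q) := fun _ _ _ => rfl
  rw [tens_apply_of_injective hinj]
  · refine Fintype.sum_equiv (Equiv.funUnique Unit Bool) _ _ fun y => ?_
    simp only [Finset.univ_unique, Finset.prod_singleton, Function.update_self]
    congr 2
    funext p
    by_cases hp : p = q
    · subst hp
      rw [Function.update_self]
      exact hinj.extend_apply y x ()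
    · rw [Function.update_of_ne hp, Function.extend_apply']
      rintro ⟨_, h⟩
      exact hp h.symm
  · intro p hp
    rw [Function.update_of_ne]
    rintro rfl
    exact hp ⟨(), rfl⟩

end tens

/-! ### Quantum circuits of bounded depth -/

open Classical in
/-- The reversible map that adds the bit `a i` to the bit `b i` for all `i ∈ s`. -/
noncomputable def addMap {Q ι : Type} (a b : ι → Q) (s : Set ι) (x : Q → Bool) : Q → Bool :=
  fun q => xor (x q) (decide (∃ i ∈ s, b i = q ∧ x (a i) = true))

theorem addMap_apply {Q ι : Type} {a b : ι → Q} {s : Set ι} (hb : Set.InjOn b s) (x : Q → Bool)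
    {i : ι} (hi : i ∈ s) : addMap a b s x (b i) = xor (x (b i)) (x (a i)) := by
  have : (∃ j ∈ s, b j = b i ∧ x (a j) = true) ↔ x (a i) = true :=
    ⟨fun ⟨j, hj, h, h'⟩ => hb hj hi h ▸ h', fun h => ⟨i, hi, rfl, h⟩⟩
  simp [addMap, this]

theorem addMap_apply_of_ne {Q ι : Type} {a b : ι → Q} {s : Set ι} (x : Q → Bool)
    {q : Q} (hq : ∀ i ∈ s, b i ≠ q) : addMap a b s x q = x q := by
  have : ¬ ∃ j ∈ s, b j = q ∧ x (a j) = true := fun ⟨j, hj, h, _⟩ => hq j hj h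
  simp [addMap, this]

/-- No target is a control, so no gate sees the effect of another one, and the product is a
simultaneous addition in the argument of `ψ`. -/
theorem foldl_cnot {Q ι : Type} [DecidableEq Q] {G : SimpleGraph Q} (k : ℕ)
    {a b : ι → Q} (hadj : ∀ i, G.Adj (a i) (b i))
    (y : Fin k → Bool) (l : List ι) (hl : l.Nodup) (hb : Set.InjOn b {i | i ∈ l})
    (hab : ∀ i ∈ l, ∀ j ∈ l, a i ≠ b j) (ψ : QState Q) :
    (l.map fun i => (⟨.cnot (a i) (b i) (hadj i), none⟩ : ControlledQGate G k)).foldl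
      (fun φ g => g.apply y φ) ψ = fun x => ψ (addMap a b {i | i ∈ l} x) := by
  induction l generalizing ψ with
  | nil =>
    funext x
    have : addMap a b {i | i ∈ ([] : List ι)} x = x := by
      funext q
      simp [addMap]
    exact congrArg ψ this.symm
  | cons i l ih =>
    rw [List.nodup_cons] at hl
    have hb' : Set.InjOn b {i | i ∈ l} := hb.mono fun j hj => List.mem_cons_of_mem _ hj
    rw [List.map_cons, List.foldl_cons, ih hl.2 hb'
      (fun i hi j hj => hab i (List.mem_cons_of_mem _ hi) j (List.mem_cons_of_mem _ hj))]
    funext x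
    simp only [ControlledQGate.apply, QGate.apply]
    have h1 : addMap a b {j | j ∈ l} x (b i) = x (b i) :=
      addMap_apply_of_ne _ fun j hj h => hl.1 (by
        rw [← hb (List.mem_cons_of_mem _ hj) List.mem_cons_self h]; exact hj)
    have h2 : addMap a b {j | j ∈ l} x (a i) = x (a i) := addMap_apply_of_ne _ fun j hj h =>
      hab i List.mem_cons_self j (List.mem_cons_of_mem _ hj) h.symm
    refine congrArg ψ (funext fun q => ?_)
    by_cases hq : q = b i
    · subst hq
      rw [Function.update_self, h1, h2]
      exact (addMap_apply hb x (i := i) List.mem_cons_self).symm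
    · rw [Function.update_of_ne hq]
      by_cases hq' : ∃ j ∈ l, b j = q
      · obtain ⟨j, hj, rfl⟩ := hq'
        exact (addMap_apply hb' x (i := j) hj).trans
          (addMap_apply hb x (i := j) (List.mem_cons_of_mem _ hj)).symm
      · push Not at hq'
        have e1 : addMap a b {j | j ∈ l} x q = x q := addMap_apply_of_ne _ hq'
        rw [e1]
        refine (addMap_apply_of_ne x ?_).symm
        intro j hj
        rcases List.mem_cons.1 hj with rfl | hj
        · exact Ne.symm hq
        · exact hq' j hj

section QImpl

variable {Q : Type} [Fintype Q] [DecidableEq Q] {G : SimpleGraph Q}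

/-- The operation `T`, which depends on one control bit for every qubit, is computed by a quantum
circuit of depth at most `D`. -/
def QImpl (G : SimpleGraph Q) (D : ℕ) (T : (Q → Bool) → QState Q → QState Q) : Prop :=
  ∃ Ls : List (DepthOneLayer G (Fintype.card Q)), Ls.length ≤ D ∧
    ∀ (y : Q → Bool) (ψ : QState Q),
      Ls.foldl (fun φ L => L.apply (fun i => y ((Fintype.equivFin Q).symm i)) φ) ψ = T y ψ

theorem QImpl.mono {D D' : ℕ} {T : (Q → Bool) → QState Q → QState Q} (h : QImpl G D T)
    (hD : D ≤ D') : QImpl G D' T := by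
  obtain ⟨Ls, hL, h⟩ := h
  exact ⟨Ls, hL.trans hD, h⟩

theorem QImpl.comp {D D' : ℕ} {T T' : (Q → Bool) → QState Q → QState Q} (h : QImpl G D T)
    (h' : QImpl G D' T') : QImpl G (D + D') fun y ψ => T' y (T y ψ) := by
  obtain ⟨Ls, hL, h⟩ := h
  obtain ⟨Ls', hL', h'⟩ := h'
  refine ⟨Ls ++ Ls', by simp; omega, fun y ψ => ?_⟩
  rw [List.foldl_append, h, h']

theorem foldl_single (k : ℕ) (U : Q → Matrix.unitaryGroup Bool ℂ) (ctrl : Q → Option (Fin k))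
    (y : Fin k → Bool) (l : List Q) (hl : l.Nodup) (ψ : QState Q) :
    (l.map fun q => (⟨.single q (U q), ctrl q⟩ : ControlledQGate G k)).foldl
      (fun φ g => g.apply y φ) ψ =
    tens (fun q => if q ∈ l then (if (ctrl q).elim true y then (U q).1 else 1) else 1) ψ := by
  induction l generalizing ψ with
  | nil => simp [tens_one]
  | cons q l ih =>
    rw [List.nodup_cons] at hl
    have key : ControlledQGate.apply (⟨.single q (U q), ctrl q⟩ : ControlledQGate G k) y ψ =
        tens (Function.update (fun _ => 1) q
          (if (ctrl q).elim true y then (U q).1 else 1)) ψ := by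
      funext x
      rw [tens_update]
      cases hc : ctrl q with
      | none => simp [ControlledQGate.apply, QGate.apply]
      | some j =>
        cases hj : y j
        · simp only [ControlledQGate.apply, hj, Option.elim, Bool.false_eq_true, if_false]
          rw [Finset.sum_eq_single (x q)]
          · simp
          · intro b _ hb
            rw [Matrix.one_apply_ne hb.symm, zero_mul]
          · simp
        · simp [ControlledQGate.apply, QGate.apply, hj]
    rw [List.map_cons, List.foldl_cons, ih hl.2, key, tens_tens]
    congr 1
    funext p
    by_cases hp : p = q
    · subst hp
      simp [hl.1]
    · simp [hp]

/-- A layer of single-qubit gates, the one on `q` controlled by the bit of `q`. -/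
theorem QImpl.condSingle (U : Q → Matrix.unitaryGroup Bool ℂ) :
    QImpl G 1 fun y ψ => tens (fun q => if y q then (U q).1 else 1) ψ := by
  refine ⟨[⟨(Finset.univ : Finset Q).toList.map fun q =>
    ⟨.single q (U q), some (Fintype.equivFin Q q)⟩, ?_⟩], by simp, fun y ψ => ?_⟩
  · rw [List.pairwise_map]
    refine (Finset.nodup_toList _).imp fun h => ?_
    simpa [QGate.support] using h
  · simp only [List.foldl_cons, List.foldl_nil, DepthOneLayer.apply]
    rw [foldl_single _ _ _ _ _ (Finset.nodup_toList _)]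
    simp

/-- A layer of single-qubit gates. -/
theorem QImpl.single (U : Q → Matrix.unitaryGroup Bool ℂ) :
    QImpl G 1 fun _ ψ => tens (fun q => (U q).1) ψ := by
  refine ⟨[⟨(Finset.univ : Finset Q).toList.map fun q => ⟨.single q (U q), none⟩, ?_⟩],
    by simp, fun y ψ => ?_⟩
  · rw [List.pairwise_map]
    refine (Finset.nodup_toList _).imp fun h => ?_
    simpa [QGate.support] using h
  · simp only [List.foldl_cons, List.foldl_nil, DepthOneLayer.apply]
    rw [foldl_single _ _ _ _ _ (Finset.nodup_toList _)]
    simp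

/-- A layer of CNOT gates. -/
theorem QImpl.cnot {ι : Type} [Finite ι] (a b : ι → Q) (s : Set ι) (h : ∀ i ∈ s, G.Adj (a i) (b i))
    (ha : Set.InjOn a s) (hb : Set.InjOn b s) (hab : ∀ i ∈ s, ∀ j ∈ s, a i ≠ b j) :
    QImpl G 1 fun _ ψ x => ψ (addMap a b s x) := by
  classical
  have := Fintype.ofFinite ι
  let l : List {i // G.Adj (a i) (b i)} := (Finset.univ.filter fun i => i.1 ∈ s).toList
  have hl : ∀ i, i ∈ l ↔ i.1 ∈ s := by simp [l]
  refine ⟨[⟨l.map fun i : {i // G.Adj (a i) (b i)} => ⟨.cnot (a i) (b i) i.2, none⟩, ?_⟩],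
    by simp, fun y ψ => ?_⟩
  · rw [List.pairwise_map]
    refine (Finset.nodup_toList _).imp_of_mem fun {i j} hi hj hne => ?_
    have hi := (hl i).1 hi
    have hj := (hl j).1 hj
    have hne' : i.1 ≠ j.1 := fun h => hne (Subtype.ext h)
    have h1 := fun h => hne' (ha hi hj h)
    have h2 := fun h => hne' (hb hi hj h)
    have h3 := hab _ hi _ hj
    have h4 := (hab _ hj _ hi).symm
    simp only [QGate.support, Finset.disjoint_insert_left, Finset.mem_insert,
      Finset.mem_singleton, Finset.disjoint_singleton_left]
    tauto
  · simp only [List.foldl_cons, List.foldl_nil, DepthOneLayer.apply]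
    rw [foldl_cnot _ (fun i : {i // G.Adj (a i) (b i)} => i.2) _ _ (Finset.nodup_toList _)
      (fun i hi j hj h => Subtype.ext (hb ((hl i).1 hi) ((hl j).1 hj) h))
      (fun i hi j hj => hab _ ((hl i).1 hi) _ ((hl j).1 hj))]
    refine funext fun x => congrArg ψ (funext fun q => ?_)
    simp only [addMap]
    congr 2
    refine propext ⟨?_, ?_⟩
    · rintro ⟨i, hi, h⟩
      exact ⟨i.1, (hl i).1 hi, h⟩
    · rintro ⟨i, hi, h'⟩
      exact ⟨⟨i, h i hi⟩, (hl _).2 hi, h'⟩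

/-- CNOT gates at a distance, through qubits in between. -/
theorem QImpl.cnot_trans {ι : Type} {D D' : ℕ} {a k b : ι → Q} {s : Set ι}
    (h : QImpl G D fun _ ψ x => ψ (addMap a k s x))
    (h' : QImpl G D' fun _ ψ x => ψ (addMap k b s x))
    (hk : Set.InjOn k s) (hb : Set.InjOn b s) (hak : ∀ i ∈ s, ∀ j ∈ s, a i ≠ k j)
    (hab : ∀ i ∈ s, ∀ j ∈ s, a i ≠ b j) (hkb : ∀ i ∈ s, ∀ j ∈ s, k i ≠ b j) :
    QImpl G (2 * D + 2 * D') fun _ ψ x => ψ (addMap a b s x) := by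
  -- Adding `k` to `b`, `a` to `k`, `k` to `b`, `a` to `k` changes `b` by `k + (k + a) = a` and
  -- restores `k`, whatever the value of `k`.
  have := (h.comp h').comp (h.comp h')
  refine cast (congrArg (QImpl G _) ?_) (this.mono (D' := 2 * D + 2 * D') (by omega))
  refine funext fun _ => funext fun ψ => funext fun x => congrArg ψ (funext fun q => ?_)
  have ka : ∀ i ∈ s, ∀ x, addMap k b s x (a i) = x (a i) := fun i hi x =>
    addMap_apply_of_ne x fun j hj => (hab i hi j hj).symm
  have aa : ∀ i ∈ s, ∀ x, addMap a k s x (a i) = x (a i) := fun i hi x =>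
    addMap_apply_of_ne x fun j hj => (hak i hi j hj).symm
  have kk : ∀ i ∈ s, ∀ x, addMap k b s x (k i) = x (k i) := fun i hi x =>
    addMap_apply_of_ne x fun j hj => (hkb i hi j hj).symm
  have ab : ∀ i ∈ s, ∀ x, addMap a k s x (b i) = x (b i) := fun i hi x =>
    addMap_apply_of_ne x fun j hj => hkb j hj i hi
  by_cases hqb : ∃ i ∈ s, b i = q
  · obtain ⟨i, hi, rfl⟩ := hqb
    simp only [ab i hi, addMap_apply hb _ hi, addMap_apply hk _ hi, kk i hi, ka i hi]
    cases x (b i) <;> cases x (k i) <;> cases x (a i) <;> rfl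
  · have nb : ∀ x, addMap k b s x q = x q := fun x =>
      addMap_apply_of_ne x fun i hi h => hqb ⟨i, hi, h⟩
    have nb' : ∀ x, addMap a b s x q = x q := fun x =>
      addMap_apply_of_ne x fun i hi h => hqb ⟨i, hi, h⟩
    by_cases hqk : ∃ i ∈ s, k i = q
    · obtain ⟨i, hi, rfl⟩ := hqk
      simp only [nb, nb', addMap_apply hk _ hi, ka i hi, aa i hi]
      cases x (k i) <;> cases x (a i) <;> rfl
    · have nk : ∀ x, addMap a k s x q = x q := fun x =>
        addMap_apply_of_ne x fun i hi h => hqk ⟨i, hi, h⟩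
      simp only [nb, nb', nk]

end QImpl

/-! ### Rounds and branches -/

namespace HybridCircuit

variable {Q : Type} [DecidableEq Q] {G : SimpleGraph Q}

/-- Every branch of a concatenation continues a branch of its first part. -/
theorem mem_branches_append (A B : HybridCircuit G) (r : ℕ × Q → Bool) (ψ φ : QState Q)
    (h : φ ∈ branches (A ++ B) r ψ) :
    ∃ r', ∃ χ ∈ branches A r ψ, φ ∈ branches B r' χ := by
  induction A generalizing r ψ with
  | nil => exact ⟨r, ψ, rfl, h⟩
  | cons R A ih =>
    simp only [List.cons_append, branches, Set.mem_iUnion] at h ⊢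
    obtain ⟨o, h⟩ := h
    obtain ⟨r', χ, hχ, h⟩ := ih _ _ h
    exact ⟨r', χ, ⟨o, hχ⟩, h⟩

/-- The number of rounds is at most `d`, the depth of the quantum circuits at most `D`, and the
classical circuits satisfy the bounds of circuits that compute parities of at most `2 ^ b` bits,
one for every qubit. -/
structure Bounded (d D b : ℕ) (A : HybridCircuit G) : Prop where
  length_le : A.length ≤ d
  quantum_le : ∀ R ∈ A, R.quantum.length ≤ D
  depth_le : ∀ R ∈ A, ∀ i, (R.classical i).depth ≤ 3 * b
  size_le : ∀ R ∈ A, ∑ i, (R.classical i).size ≤ 2 ^ (4 * b + 1)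

theorem Bounded.append {d d' D b : ℕ} {A B : HybridCircuit G} (hA : Bounded d D b A)
    (hB : Bounded d' D b B) : Bounded (d + d') D b (A ++ B) where
  length_le := by
    have := hA.length_le
    have := hB.length_le
    simp only [List.length_append]; omega
  quantum_le R hR := (List.mem_append.1 hR).elim (hA.quantum_le R) (hB.quantum_le R)
  depth_le R hR := (List.mem_append.1 hR).elim (hA.depth_le R) (hB.depth_le R)
  size_le R hR := (List.mem_append.1 hR).elim (hA.size_le R) (hB.size_le R)

end HybridCircuit

section round

variable {Q : Type} [DecidableEq Q] {G : SimpleGraph Q}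

/-- The outcomes of a measurement of the qubits in `M`, extended by `false`. -/
def outcomeRecord {M : Finset Q} (o : M → Bool) (q : Q) : Bool :=
  if h : q ∈ M then o ⟨q, h⟩ else false

/-- The projection onto the strings that agree with `s` on `M`. -/
def projectOn (M : Finset Q) (s : Q → Bool) (ψ : QState Q) : QState Q :=
  fun x => if ∀ q ∈ M, x q = s q then ψ x else 0

theorem project_eq (R : HybridRound G) (o : R.measured → Bool) (ψ : QState Q) :
    R.project o ψ = projectOn R.measured (outcomeRecord o) ψ := by
  funext x
  have : (∀ q : R.measured, x q = o q) ↔ ∀ q ∈ R.measured, x q = outcomeRecord o q :=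
    ⟨fun h q hq => by simp [outcomeRecord, hq, h ⟨q, hq⟩], fun h q => by
      simp [h q.1 q.2, outcomeRecord]⟩
  simp only [HybridRound.project, projectOn, this]

/-- A round that applies `T`, with the parities of the last outcomes in `S q` as control bits, and
measures `M`. -/
theorem exists_round [Fintype Q] {D b : ℕ} (hQ : Fintype.card Q ≤ 2 ^ b) (S : Q → Finset Q)
    {T : (Q → Bool) → QState Q → QState Q} (hT : QImpl G D T) (M : Finset Q) :
    ∃ R : HybridRound G, HybridCircuit.Bounded 1 D b [R] ∧ ∀ (A : HybridCircuit G) r ψ φ,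
      φ ∈ HybridCircuit.branches (R :: A) r ψ →
      ∃ (s : Q → Bool) (r' : ℕ × Q → Bool) (b : Q → Bool), (∀ q, r' (0, q) = s q) ∧
        (∀ q, b q = parity (S q) fun p => r (0, p)) ∧
        φ ∈ HybridCircuit.branches A r' (projectOn M s (T b ψ)) := by
  obtain ⟨Ls, hL, hT⟩ := hT
  choose f hf hf' using fun q => BoolFormula.exists_eval_eq_parity (fun p : Q => (0, p)) b (S q)
    ((Finset.card_le_univ _).trans hQ)
  let R : HybridRound G := ⟨Fintype.card Q, fun i => f ((Fintype.equivFin Q).symm i), Ls, M⟩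
  refine ⟨R,
    ⟨by simp, by simpa using hL, by simpa using fun i => hf _, ?_⟩, ?_⟩
  · simp only [List.mem_singleton, forall_eq]
    calc ∑ i, (f ((Fintype.equivFin Q).symm i)).size
        ≤ ∑ _i : Fin (Fintype.card Q), 2 ^ (3 * b + 1) :=
          Finset.sum_le_sum fun i _ => (BoolFormula.size_lt_two_pow _).le.trans
            (Nat.pow_le_pow_right (by norm_num)
              (by have := hf ((Fintype.equivFin Q).symm i); omega))
      _ = Fintype.card Q * 2 ^ (3 * b + 1) := by simp
      _ ≤ 2 ^ b * 2 ^ (3 * b + 1) := Nat.mul_le_mul_right _ hQ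
      _ = 2 ^ (4 * b + 1) := by rw [← pow_add]; congr 1; ring
  · intro A r ψ φ h
    simp only [HybridCircuit.branches, Set.mem_iUnion] at h
    obtain ⟨o, h⟩ := h
    rw [project_eq] at h
    refine ⟨outcomeRecord o, R.pushRecord o r, _, fun q => rfl, fun q => rfl, ?_⟩
    convert h using 2
    simp only [HybridRound.applyQuantum, R, hf', ← hT]

end round

/-! ### Single-qubit gates -/

/-- The Hadamard gate. -/
noncomputable def hadamardMatrix : Matrix Bool Bool ℂ :=
  Matrix.of fun a b => ((Real.sqrt 2)⁻¹ : ℝ) * bsign (a && b)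

theorem inv_sqrt_two_mul_self :
    (((Real.sqrt 2)⁻¹ : ℝ) : ℂ) * (((Real.sqrt 2)⁻¹ : ℝ) : ℂ) = 1 / 2 := by
  rw [← Complex.ofReal_mul, ← mul_inv, Real.mul_self_sqrt (by norm_num)]
  norm_num

theorem hadamardMatrix_mul_self : hadamardMatrix * hadamardMatrix = 1 := by
  have h := inv_sqrt_two_mul_self
  ext a b
  rw [Matrix.mul_apply, Fintype.sum_bool]
  cases a <;> cases b <;> simp [hadamardMatrix] at h ⊢ <;> linear_combination 2 * h

theorem star_hadamardMatrix : star hadamardMatrix = hadamardMatrix := by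
  ext a b
  cases a <;> cases b <;> simp [hadamardMatrix, Matrix.star_apply]

/-- The Hadamard gate as a unitary. -/
noncomputable def hadamardGate : Matrix.unitaryGroup Bool ℂ :=
  ⟨hadamardMatrix, Matrix.mem_unitaryGroup_iff.2 (by
    rw [star_hadamardMatrix, hadamardMatrix_mul_self])⟩

/-- The bit flip. -/
def flipMatrix : Matrix Bool Bool ℂ := Matrix.of fun a b => if a = b then 0 else 1

/-- The bit flip as a unitary. -/
noncomputable def flipGate : Matrix.unitaryGroup Bool ℂ :=
  ⟨flipMatrix, Matrix.mem_unitaryGroup_iff.2 (by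
    ext a b
    rw [Matrix.mul_apply, Fintype.sum_bool]
    cases a <;> cases b <;> simp [flipMatrix, Matrix.star_apply])⟩

/-- The phase `exp (i θ b)`. -/
noncomputable def phase (θ : ℝ) (b : Bool) : ℂ := if b then Complex.exp (θ * Complex.I) else 1

@[simp] theorem phase_false (θ : ℝ) : phase θ false = 1 := rfl

theorem phase_true (θ : ℝ) : phase θ true = Complex.exp (θ * Complex.I) := rfl

@[simp] theorem phase_zero (b : Bool) : phase 0 b = 1 := by cases b <;> simp [phase]

theorem phase_mul_conj (θ : ℝ) (b : Bool) : phase θ b * star (phase θ b) = 1 := by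
  cases b
  · simp
  · simp only [phase, if_true, Complex.star_def]
    rw [← Complex.exp_conj, ← Complex.exp_add]
    simp

/-- The phase gate as a unitary. -/
noncomputable def phaseGate (θ : ℝ) : Matrix.unitaryGroup Bool ℂ :=
  ⟨Matrix.diagonal (phase θ), Matrix.mem_unitaryGroup_iff.2 (by
    rw [Matrix.star_eq_conjTranspose, Matrix.diagonal_conjTranspose, Matrix.diagonal_mul_diagonal]
    simp only [Pi.star_apply, phase_mul_conj]
    exact Matrix.diagonal_one)⟩

theorem phase_pi (b : Bool) : phase Real.pi b = bsign b := by
  cases b <;> simp [phase, bsign]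

/-! ### Measurement-based encoding -/

theorem parity_image {Q : Type} [DecidableEq Q] {α : Type} {e : α → Q}
    (he : Function.Injective e) (S : Finset α) (t : Q → Bool) :
    parity (S.image e) t = parity S fun a => t (e a) := by
  apply bsign_injective
  rw [bsign_parity, bsign_parity, Finset.prod_image he.injOn]

/-- The map `V` adds parities to the check bits, such that the bits of the ancillas `anc` are
determined, as parities, by the check bits and the bits of the remaining qubits. -/
structure IsEncoder {Q α : Type} (anc chk : α → Q) (V : (Q → Bool) → Q → Bool) : Prop where
  anc_injective : Function.Injective anc
  anc_ne_chk : ∀ a a', anc a ≠ chk a'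
  involutive : ∀ x, V (V x) = x
  apply_of_ne : ∀ x q, (∀ a, chk a ≠ q) → V x q = x q
  determined : ∀ a, ∃ S E : Finset Q, (∀ q ∈ S, ∀ a', anc a' ≠ q ∧ chk a' ≠ q) ∧
    (∀ q ∈ E, ∃ a', chk a' = q) ∧ ∀ x, (∀ c, x (chk c) = false) →
      x (anc a) = xor (parity S x) (parity E (V x))

/-- The reason why bit flips suffice as correction. Here `s` holds the measured checks, `x'` is a
string before the correction and `x` the one after it; `x'` stems from an admissible initial string
exactly if `x` satisfies all parity relations. For the converse, `determined` makes the map from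
ancilla values to check values injective. Both are indexed by `α`, so it is surjective and some
ancilla values produce the outcomes `s`. -/
theorem IsEncoder.check_iff {Q α : Type} [Finite α] {anc chk : α → Q}
    {V : (Q → Bool) → Q → Bool} (h : IsEncoder anc chk V) {S E : α → Finset Q}
    (hS : ∀ a, ∀ q ∈ S a, ∀ a', anc a' ≠ q ∧ chk a' ≠ q) (hE : ∀ a, ∀ q ∈ E a, ∃ a', chk a' = q)
    (hSE : ∀ a x, (∀ c, x (chk c) = false) →
      x (anc a) = xor (parity (S a) x) (parity (E a) (V x)))
    (s x x' : Q → Bool) (hx : ∀ c, x (chk c) = false) (hc : ∀ c, x' (chk c) = s (chk c))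
    (ha : ∀ a, x' (anc a) = xor (x (anc a)) (parity (E a) s))
    (hr : ∀ q, (∀ a, anc a ≠ q) → (∀ a, chk a ≠ q) → x' q = x q) :
    (∀ c, V x' (chk c) = false) ↔ ∀ a, x (anc a) = parity (S a) x := by
  constructor
  · intro hV a
    have h1 := hSE a (V x') hV
    rw [h.involutive, h.apply_of_ne _ _ fun c => (h.anc_ne_chk a c).symm, ha] at h1
    have h2 : parity (E a) x' = parity (E a) s := parity_congr fun q hq => by
      obtain ⟨c, rfl⟩ := hE a q hq
      exact hc c
    have h3 : parity (S a) (V x') = parity (S a) x := parity_congr fun q hq => by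
      rw [h.apply_of_ne _ _ fun c => (hS a q hq c).2]
      exact hr q (fun c => (hS a q hq c).1) fun c => (hS a q hq c).2
    rw [h2, h3] at h1
    simpa using h1
  · intro hxS
    have hext : ∀ (u : α → Bool) c, Function.extend anc u x (chk c) = false := fun u c => by
      rw [Function.extend_apply' _ _ _ fun ⟨a, ha⟩ => h.anc_ne_chk a c ha, hx]
    have hval : ∀ (u : α → Bool) a,
        u a = xor (parity (S a) x) (parity (E a) (V (Function.extend anc u x))) := fun u a => by
      have := hSE a (Function.extend anc u x) (hext u)
      rw [h.anc_injective.extend_apply] at this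
      rw [this]
      congr 1
      exact parity_congr fun q hq =>
        Function.extend_apply' _ _ _ fun ⟨a', ha'⟩ => (hS a q hq a').1 ha'
    have hinj : Function.Injective
        fun (u : α → Bool) c => V (Function.extend anc u x) (chk c) := by
      intro u u' huu
      funext a
      rw [hval u a, hval u' a]
      congr 1
      refine parity_congr fun q hq => ?_
      obtain ⟨c, rfl⟩ := hE a q hq
      exact congrFun huu c
    obtain ⟨u, hu⟩ := Finite.surjective_of_injective hinj fun c => s (chk c)
    -- By `determined`, ancilla values with outcomes `s` must be `parity (S a) x` plus `parity (E a)
    -- s`, which are those of `x'`.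
    have hu' : V (Function.extend anc u x) = x' := by
      funext q
      by_cases hq : ∃ c, chk c = q
      · obtain ⟨c, rfl⟩ := hq
        rw [hc]
        exact congrFun hu c
      · push Not at hq
        rw [h.apply_of_ne _ _ hq]
        by_cases hq' : ∃ a, anc a = q
        · obtain ⟨a, rfl⟩ := hq'
          rw [h.anc_injective.extend_apply, ha, hval u a, hxS a]
          congr 1
          refine parity_congr fun q hq => ?_
          obtain ⟨c, rfl⟩ := hE a q hq
          exact congrFun hu c
        · rw [Function.extend_apply' _ _ _ hq', hr q (fun a ha => hq' ⟨a, ha⟩) hq]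
    intro c
    rw [← hu', h.involutive, hext]

section gadget

variable {Q : Type} [Fintype Q] [DecidableEq Q] {G : SimpleGraph Q}

/-- Bit flips on `F` and sign flips outside `F`, as prescribed by `b`. -/
theorem tens_correction (F : Finset Q) (b : Q → Bool) (ψ : QState Q) (x : Q → Bool) :
    tens (fun q => if b q then (if q ∈ F then flipGate else phaseGate Real.pi).1 else 1) ψ x =
      (∏ q, if q ∈ F then 1 else bsign (x q && b q)) *
        ψ (fun q => if q ∈ F then xor (x q) (b q) else x q) := by
  rw [tens_eq_single _ _ x (fun q => if q ∈ F then xor (x q) (b q) else x q)]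
  · congr 1
    refine Finset.prod_congr rfl fun q _ => ?_
    by_cases hq : q ∈ F
    · simp only [if_pos hq]
      cases hb : b q
      · simp [Matrix.one_apply]
      · cases x q <;> simp [flipGate, flipMatrix]
    · simp only [if_neg hq]
      cases hb : b q <;> cases x q <;> simp [phaseGate, phase_pi]
  · intro z hz
    obtain ⟨q, hq⟩ := Function.ne_iff.1 hz
    refine Or.inl ⟨q, ?_⟩
    by_cases hF : q ∈ F
    · simp only [hF, if_true] at hq
      cases hb : b q <;> cases hx : x q <;> cases hz : z q <;>
        simp_all [flipGate, flipMatrix]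
    · simp only [hF, if_false] at hq
      cases hb : b q <;> cases hx : x q <;> cases hz : z q <;>
        simp_all [phaseGate]

variable {α : Type} [Fintype α] {anc chk : α → Q} {V : (Q → Bool) → Q → Bool}

/-- The string `x` with the bits of the ancillas set to `false`. -/
def clear (F : Finset Q) (x : Q → Bool) : Q → Bool := fun q => if q ∈ F then false else x q

/-- Qubits of `F` in `|0⟩` become `|+⟩`, so the new amplitude does not depend on the bits in `F`. -/
theorem tens_hadamard_of_clear (F : Finset Q) (ψ : QState Q)
    (hψ : ∀ x, ∀ q ∈ F, x q = true → ψ x = 0) (x : Q → Bool) :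
    tens (fun q => (if q ∈ F then hadamardGate else 1 : Matrix.unitaryGroup Bool ℂ).1) ψ x =
      (((Real.sqrt 2)⁻¹ : ℝ) : ℂ) ^ F.card * ψ (clear F x) := by
  rw [tens_eq_single _ _ x (clear F x)]
  · congr 1
    rw [← Finset.prod_const, ← Finset.prod_subset (Finset.subset_univ F)]
    · refine Finset.prod_congr rfl fun q hq => ?_
      simp [hq, clear, hadamardGate, hadamardMatrix]
    · intro q _ hq
      simp [hq, clear]
  · intro z hz
    obtain ⟨q, hq⟩ := Function.ne_iff.1 hz
    by_cases hF : q ∈ F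
    · refine Or.inr (hψ z q hF ?_)
      simpa [clear, hF] using hq
    · refine Or.inl ⟨q, ?_⟩
      simp only [clear, hF, if_false] at hq
      simp [hF, Matrix.one_apply_ne (Ne.symm hq)]

/-- Measuring parities encodes the ancillas, so that phases can be applied that depend on the
parities; measuring the ancillas in the Hadamard basis disentangles them again. -/
theorem IsEncoder.exists_phase_circuit (h : IsEncoder anc chk V) {D D₁ D₂ b : ℕ}
    (hQ : Fintype.card Q ≤ 2 ^ b) (hV : QImpl G D₁ fun _ ψ x => ψ (V x))
    {L : (Q → Bool) → Q → Bool} (hLL : ∀ x, L (L x) = x) (hL : QImpl G D₂ fun _ ψ x => ψ (L x))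
    (hD₁ : 1 + D₁ ≤ D) (hD₂ : 3 + 2 * D₂ ≤ D) (ω : Q → ℝ) (Φ : (Q → Bool) → ℂ)
    (hΦ : ∀ y, (∀ a, y (chk a) = false) → (∀ a, V y (chk a) = false) →
      ∏ q, phase (ω q) (L y q) = Φ (clear (Finset.univ.image anc) y)) :
    ∃ A : HybridCircuit G, HybridCircuit.Bounded 3 D b A ∧ ∀ ψ : QState Q,
      (∀ x, (∃ a, x (anc a) = true ∨ x (chk a) = true) → ψ x = 0) →
      ∀ r, ∀ φ ∈ HybridCircuit.branches A r ψ, ∃ c : ℂ, φ = c • fun x => Φ x * ψ x := by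
  choose S E hS hE hSE using h.determined
  set F : Finset Q := Finset.univ.image anc with hF
  set C : Finset Q := Finset.univ.image chk with hC
  have memF : ∀ {q}, q ∈ F ↔ ∃ a, anc a = q := by simp [hF]
  have memC : ∀ {q}, q ∈ C ↔ ∃ a, chk a = q := by simp [hC]
  have ancF : ∀ a, anc a ∈ F := fun a => memF.2 ⟨a, rfl⟩
  have chkC : ∀ a, chk a ∈ C := fun a => memC.2 ⟨a, rfl⟩
  have ancC : ∀ a, anc a ∉ C := fun a ha => by
    obtain ⟨c, hc⟩ := memC.1 ha
    exact h.anc_ne_chk a c hc.symm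
  have chkF : ∀ a, chk a ∉ F := fun a ha => by
    obtain ⟨c, hc⟩ := memF.1 ha
    exact h.anc_ne_chk c a hc
  let H : Q → Matrix.unitaryGroup Bool ℂ := fun q => if q ∈ F then hadamardGate else 1
  let X : Q → Matrix.unitaryGroup Bool ℂ :=
    fun q => if q ∈ F ∪ C then flipGate else phaseGate Real.pi
  -- Since `L` is an involution, conjugating a layer of phase gates with it gives the phases of the
  -- bits of `L x`.
  have hphase : QImpl G (D₂ + 1 + D₂) fun _ (ψ : QState Q) x =>
      (∏ q, phase (ω q) (L x q)) * ψ x := by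
    have := (hL.comp (QImpl.single fun q => phaseGate (ω q))).comp hL
    refine cast (congrArg (QImpl G _) ?_) this
    funext _ ψ x
    simp only [phaseGate, tens_diagonal, hLL]
  -- Round one puts the ancillas into `|+⟩`, adds the parities to the check qubits and measures
  -- these; its gates are unconditional.
  obtain ⟨R₁, hR₁, hb₁⟩ := exists_round hQ (fun _ => ∅) (((QImpl.single H).comp hV).mono hD₁) C
  -- A check qubit is reset by its own outcome, and `anc a` is flipped by the parity of the outcomes
  -- in `E a`. The phases and the Hadamard measurement of the ancillas follow.
  obtain ⟨R₂, hR₂, hb₂⟩ := exists_round hQ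
    (fun q => if q ∈ C then {q} else Finset.univ.filter fun p => ∃ a, anc a = q ∧ p ∈ E a)
    ((((QImpl.condSingle X).comp hphase).comp (QImpl.single H)).mono
      (show 1 + (D₂ + 1 + D₂) + 1 ≤ D by omega)) F
  -- An ancilla is reset by its own outcome; a remaining qubit gets a sign flip for the parity of
  -- the outcomes of those ancillas whose parity relation involves it.
  obtain ⟨R₃, hR₃, hb₃⟩ := exists_round hQ
    (fun q => if q ∈ F then {q} else if q ∈ C then ∅ else
      (Finset.univ.filter fun a => q ∈ S a).image anc)
    ((QImpl.condSingle X).mono (show 1 ≤ D by omega)) ∅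
  refine ⟨[R₁] ++ [R₂] ++ [R₃], (hR₁.append hR₂).append hR₃, fun ψ hψ r φ hφ => ?_⟩
  obtain ⟨s, r₁, _, hr₁, _, hφ⟩ := hb₁ _ _ _ _ hφ
  obtain ⟨t, r₂, b₂, hr₂, hb₂', hφ⟩ := hb₂ _ _ _ _ hφ
  obtain ⟨_, _, b₃, _, hb₃', hφ⟩ := hb₃ _ _ _ _ hφ
  simp only [HybridCircuit.branches, Set.mem_singleton_iff] at hφ
  set κ : ℂ := (((Real.sqrt 2)⁻¹ : ℝ) : ℂ) ^ F.card with hκ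
  -- the state after the first measurement
  obtain ⟨ψ₁, hψ₁⟩ : ∃ ψ₁, ψ₁ = projectOn C s fun x => tens (fun q => (H q).1) ψ (V x) := ⟨_, rfl⟩
  have e₁ : ∀ x, ψ₁ x = if ∀ c, x (chk c) = s (chk c) then κ * ψ (clear F (V x)) else 0 := by
    intro x
    rw [hψ₁]
    have : (∀ q ∈ C, x q = s q) ↔ ∀ c, x (chk c) = s (chk c) := by simp [hC]
    simp only [projectOn, this, H]
    rw [tens_hadamard_of_clear F ψ]
    intro x q hq hx
    obtain ⟨a, rfl⟩ := memF.1 hq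
    exact hψ x ⟨a, Or.inl hx⟩
  rw [← hψ₁] at hφ
  -- the state after the first correction
  have hb₂chk : ∀ c, b₂ (chk c) = s (chk c) := fun c => by
    rw [hb₂']; simp [chkC, hr₁]
  have hb₂anc : ∀ a, b₂ (anc a) = parity (E a) s := fun a => by
    have : (Finset.univ.filter fun p => ∃ a', anc a' = anc a ∧ p ∈ E a') = E a := by
      ext p
      simp [h.anc_injective.eq_iff]
    rw [hb₂']; simp only [ancC, if_false, this, hr₁]
  have hb₂else : ∀ q, q ∉ F ∪ C → b₂ q = false := fun q hq => by
    rw [Finset.mem_union, not_or] at hq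
    have : (Finset.univ.filter fun p => ∃ a, anc a = q ∧ p ∈ E a) = ∅ := by
      ext p
      simp only [Finset.mem_filter, Finset.mem_univ, true_and, Finset.notMem_empty, iff_false]
      rintro ⟨a, ha, _⟩
      exact hq.1 (memF.2 ⟨a, ha⟩)
    rw [hb₂']; simp only [hq.2, if_false, this, parity_empty]
  obtain ⟨ψ₂, hψ₂⟩ : ∃ ψ₂, ψ₂ = tens (fun q => if b₂ q = true then (X q).1 else 1) ψ₁ := ⟨_, rfl⟩
  have e₂ : ∀ x, ψ₂ x = if (∀ c, x (chk c) = false) ∧ ∀ a, x (anc a) = parity (S a) x then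
      κ * ψ (clear F x) else 0 := by
    intro x
    rw [hψ₂, tens_correction]
    have hsign : (∏ q, if q ∈ F ∪ C then (1 : ℂ) else bsign (x q && b₂ q)) = 1 :=
      Finset.prod_eq_one fun q _ => by
        split_ifs with hq
        · rfl
        · simp [hb₂else q hq]
    rw [hsign, one_mul]
    obtain ⟨x', hx'⟩ : ∃ x' : Q → Bool, x' = fun q => if q ∈ F ∪ C then xor (x q) (b₂ q) else x q :=
      ⟨_, rfl⟩
    have hx'C : ∀ c, x' (chk c) = xor (x (chk c)) (s (chk c)) := fun c => by
      simp [hx', chkC, hb₂chk]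
    have hx'F : ∀ a, x' (anc a) = xor (x (anc a)) (parity (E a) s) := fun a => by
      simp [hx', ancF, hb₂anc]
    have hx'r : ∀ q, (∀ a, anc a ≠ q) → (∀ a, chk a ≠ q) → x' q = x q := fun q h₁ h₂ => by
      have : q ∉ F ∪ C := by
        rw [Finset.mem_union, memF, memC]
        rintro (⟨a, ha⟩ | ⟨a, ha⟩)
        exacts [h₁ a ha, h₂ a ha]
      simp only [hx', this, if_false]
    rw [← hx', e₁]
    by_cases hx : ∀ c, x (chk c) = false
    · have hc : ∀ c, x' (chk c) = s (chk c) := fun c => by simp [hx'C, hx]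
      rw [if_pos hc]
      have key := h.check_iff hS hE hSE s x x' hx hc hx'F hx'r
      by_cases hxS : ∀ a, x (anc a) = parity (S a) x
      · rw [if_pos ⟨hx, hxS⟩]
        congr 2
        funext q
        by_cases hq : q ∈ F
        · simp [clear, hq]
        · simp only [clear, hq, if_false]
          by_cases hq' : q ∈ C
          · obtain ⟨c, rfl⟩ := memC.1 hq'
            rw [key.2 hxS, hx]
          · have h₂ : ∀ a, chk a ≠ q := fun a ha => hq' (memC.2 ⟨a, ha⟩)
            rw [h.apply_of_ne _ _ h₂, hx'r q (fun a ha => hq (memF.2 ⟨a, ha⟩)) h₂]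
      · rw [if_neg fun h => hxS h.2]
        have : ¬ ∀ c, V x' (chk c) = false := fun h => hxS (key.1 h)
        push Not at this
        obtain ⟨c, hc⟩ := this
        rw [hψ, mul_zero]
        exact ⟨c, Or.inr (by simpa [clear, chkF] using hc)⟩
    · rw [if_neg (c := (∀ c, x (chk c) = false) ∧ _) fun h => hx h.1, if_neg]
      intro hc
      refine hx fun c => ?_
      have := hc c
      rw [hx'C] at this
      revert this
      cases x (chk c) <;> cases s (chk c) <;> simp
  rw [← hψ₂] at hφ
  -- the state after the phases and the Hadamard gates
  obtain ⟨ψ₄, hψ₄⟩ : ∃ ψ₄, ψ₄ = tens (fun q => (H q).1)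
    fun x => (∏ q, phase (ω q) (L x q)) * ψ₂ x := ⟨_, rfl⟩
  have e₄ : ∀ x, (∀ c, x (chk c) = false) → ψ₄ x =
      κ * (∏ a, bsign (x (anc a) && parity (S a) x)) *
        (Φ (clear F x) * (κ * ψ (clear F x))) := by
    intro x hx
    -- Where the checks vanish, a single string contributes to the amplitude at `x`: the encoded
    -- string with the same bits outside the ancillas.
    set y := Function.extend anc (fun a => parity (S a) x) x with hy
    have hyF : ∀ a, y (anc a) = parity (S a) x := fun a => h.anc_injective.extend_apply _ _ _
    have hyr : ∀ q, q ∉ F → y q = x q := fun q hq =>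
      Function.extend_apply' _ _ _ fun ha => hq (memF.2 ha)
    have hyC : ∀ c, y (chk c) = false := fun c => by rw [hyr _ (chkF c), hx]
    have hyS : ∀ a, parity (S a) y = parity (S a) x := fun a => parity_congr fun q hq =>
      hyr q fun hq' => by
        obtain ⟨a', ha'⟩ := memF.1 hq'
        exact (hS a q hq a').1 ha'
    have hyclear : clear F y = clear F x := by
      funext q
      by_cases hq : q ∈ F
      · simp [clear, hq]
      · simp [clear, hq, hyr]
    have hyV : ∀ a, V y (chk a) = false :=
      (h.check_iff hS hE hSE (fun _ => false) y y hyC hyC (fun a => by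
        have : parity (E a) (fun _ => false) = false := by
          apply bsign_injective
          rw [bsign_parity]
          simp
        simp [this]) fun _ _ _ => rfl).2 fun a => by rw [hyF, hyS]
    rw [hψ₄, tens_eq_single _ _ x y]
    · congr 1
      · rw [← Fintype.prod_of_injective anc h.anc_injective
          (fun a => (((Real.sqrt 2)⁻¹ : ℝ) : ℂ) * bsign (x (anc a) && parity (S a) x))]
        · rw [Finset.prod_mul_distrib, Finset.prod_const, hκ, hF,
            Finset.card_image_of_injective _ h.anc_injective]
        · intro q hq
          have hq : q ∉ F := fun h => hq (memF.1 h)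
          simp [H, hq, hyr q hq]
        · intro a
          simp [H, ancF, hyF, hadamardGate, hadamardMatrix]
      · rw [hΦ y hyC hyV, e₂, if_pos ⟨hyC, fun a => by rw [hyF, hyS]⟩, hyclear]
    · intro z hz
      by_cases hzS : (∀ c, z (chk c) = false) ∧ ∀ a, z (anc a) = parity (S a) z
      · by_cases hzr : ∀ q, q ∉ F → z q = x q
        · exfalso
          apply hz
          funext q
          by_cases hq : q ∈ F
          · obtain ⟨a, rfl⟩ := memF.1 hq
            rw [hyF, hzS.2]
            refine parity_congr fun q hq => hzr q fun hq' => ?_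
            obtain ⟨a', ha'⟩ := memF.1 hq'
            exact (hS a q hq a').1 ha'
          · rw [hzr q hq, hyr q hq]
        · push Not at hzr
          obtain ⟨q, hq, hqz⟩ := hzr
          refine Or.inl ⟨q, ?_⟩
          simp [H, hq, Matrix.one_apply_ne (Ne.symm hqz)]
      · refine Or.inr ?_
        rw [e₂, if_neg hzS, mul_zero]
  have e₄' : ∀ x, (∃ c, x (chk c) = true) → ψ₄ x = 0 := by
    rintro x ⟨c, hc⟩
    rw [hψ₄]
    refine Finset.sum_eq_zero fun z _ => ?_
    by_cases hzc : z (chk c) = true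
    · have : ψ₂ z = 0 := by rw [e₂, if_neg fun h => by simp [h.1 c] at hzc]
      simp only [this, mul_zero]
    · rw [Finset.prod_eq_zero (Finset.mem_univ (chk c)), zero_mul]
      have : x (chk c) ≠ z (chk c) := by rw [hc]; exact fun h => hzc h.symm
      simp [H, chkF, Matrix.one_apply_ne this]
  rw [← hψ₄] at hφ
  -- the final correction
  refine ⟨κ * κ, ?_⟩
  rw [hφ]
  have hb₃anc : ∀ a, b₃ (anc a) = t (anc a) := fun a => by
    rw [hb₃']; simp [ancF, hr₂]
  have hb₃chk : ∀ c, b₃ (chk c) = false := fun c => by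
    rw [hb₃']; simp [chkF, chkC]
  have hb₃else : ∀ q, q ∉ F ∪ C →
      b₃ q = parity (Finset.univ.filter fun a => q ∈ S a) fun a => t (anc a) := fun q hq => by
    rw [Finset.mem_union, not_or] at hq
    rw [hb₃']; simp only [hq.1, hq.2, if_false, parity_image h.anc_injective, hr₂]
  funext x
  simp only [projectOn, Finset.notMem_empty, false_imp_iff, implies_true, if_true, Pi.smul_apply,
    smul_eq_mul, X]
  rw [tens_correction]
  have hproj : ∀ y, projectOn F t ψ₄ y = if ∀ q ∈ F, y q = t q then ψ₄ y else 0 := fun y => by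
    unfold projectOn
    split_ifs <;> rfl
  obtain ⟨x', hx'⟩ : ∃ x' : Q → Bool, x' = fun q => if q ∈ F ∪ C then xor (x q) (b₃ q) else x q :=
    ⟨_, rfl⟩
  rw [← hx', hproj]
  have hx'C : ∀ c, x' (chk c) = x (chk c) := fun c => by simp [hx', chkC, hb₃chk]
  have hx'F : ∀ a, x' (anc a) = xor (x (anc a)) (t (anc a)) := fun a => by
    simp [hx', ancF, hb₃anc]
  have hx'r : ∀ q, q ∉ F ∪ C → x' q = x q := fun q hq => by simp only [hx', hq, if_false]
  by_cases hxC : ∃ c, x (chk c) = true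
  · obtain ⟨c, hc⟩ := hxC
    rw [hψ x ⟨c, Or.inr hc⟩, e₄' x' ⟨c, by rw [hx'C, hc]⟩]
    simp
  push Not at hxC
  simp only [Bool.not_eq_true] at hxC
  by_cases hxF : ∃ a, x (anc a) = true
  · obtain ⟨a, ha⟩ := hxF
    rw [hψ x ⟨a, Or.inl ha⟩, if_neg]
    · simp
    · intro hc
      have := hc _ (ancF a)
      rw [hx'F, ha] at this
      simp at this
  push Not at hxF
  simp only [Bool.not_eq_true] at hxF
  have hclear : clear F x' = x := by
    funext q
    by_cases hq : q ∈ F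
    · obtain ⟨a, rfl⟩ := memF.1 hq
      simp [clear, hq, hxF]
    · simp only [clear, hq, if_false]
      by_cases hq' : q ∈ C
      · obtain ⟨c, rfl⟩ := memC.1 hq'
        exact hx'C c
      · exact hx'r q (by simp [hq, hq'])
  rw [if_pos, e₄ x' fun c => by rw [hx'C, hxC], hclear]
  swap
  · intro q hq
    obtain ⟨a, rfl⟩ := memF.1 hq
    simp [hx'F, hxF]
  -- The sign flips on the data amount, after exchanging sums, to the very sign that the Hadamard
  -- measurement left behind (`hsign₂`), so the two cancel (`hsq`).
  have hsign₁ : (∏ q, if q ∈ F ∪ C then (1 : ℂ) else bsign (x q && b₃ q)) =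
      ∏ a, bsign (t (anc a) && parity (S a) x) := by
    rw [prod_bsign_and_parity]
    refine Finset.prod_congr rfl fun q _ => ?_
    split_ifs with hq
    · have : x q = false := by
        rcases Finset.mem_union.1 hq with hq | hq
        · obtain ⟨a, rfl⟩ := memF.1 hq
          exact hxF a
        · obtain ⟨a, rfl⟩ := memC.1 hq
          exact hxC a
      simp [this]
    · rw [hb₃else q hq]
  have hsign₂ : ∏ a, bsign (x' (anc a) && parity (S a) x') =
      ∏ a, bsign (t (anc a) && parity (S a) x) := by
    refine Finset.prod_congr rfl fun a _ => ?_
    have h₁ : parity (S a) x' = parity (S a) x := parity_congr fun q hq => hx'r q (by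
      rw [Finset.mem_union, memF, memC]
      rintro (⟨a', ha'⟩ | ⟨a', ha'⟩)
      exacts [(hS a q hq a').1 ha', (hS a q hq a').2 ha'])
    rw [h₁, hx'F, hxF, Bool.false_xor]
  have hsq : (∏ a, bsign (t (anc a) && parity (S a) x)) *
      (∏ a, bsign (t (anc a) && parity (S a) x)) = 1 := by
    rw [← Finset.prod_mul_distrib]
    exact Finset.prod_eq_one fun a _ => bsign_mul_self _
  rw [hsign₁, hsign₂]
  linear_combination κ * κ * Φ x * ψ x * hsq

end gadget

/-! ### Operations on a data register and an auxiliary register -/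

section realizes

variable {Q : Type} [Fintype Q] [DecidableEq Q] {G : SimpleGraph Q}
  {ι κ : Type} [Fintype ι] [DecidableEq ι] [Fintype κ] [DecidableEq κ]

open Classical in
/-- The state of all qubits that is `φ` on the registers `X` and `Y` and `|0⟩` elsewhere. -/
noncomputable def registerState (X : ι → Q) (Y : κ → Q) (φ : (ι → Bool) → (κ → Bool) → ℂ) :
    QState Q :=
  fun z => if ∀ q, q ∉ Set.range X → q ∉ Set.range Y → z q = false then
    φ (fun i => z (X i)) (fun j => z (Y j)) else 0

theorem registerState_smul (X : ι → Q) (Y : κ → Q) (c : ℂ) (φ : (ι → Bool) → (κ → Bool) → ℂ) :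
    registerState X Y (c • φ) = c • registerState X Y φ := by
  funext z
  simp only [registerState, Pi.smul_apply, smul_eq_mul]
  split_ifs <;> simp

/-- A circuit with at most `d` rounds that applies the operation `T` to the two registers, up to a
scalar factor that depends on the branch. -/
def Realizes (G : SimpleGraph Q) (X : ι → Q) (Y : κ → Q) (D b d : ℕ)
    (T : ((ι → Bool) → (κ → Bool) → ℂ) → (ι → Bool) → (κ → Bool) → ℂ) : Prop :=
  (∀ (c : ℂ) φ, T (c • φ) = c • T φ) ∧ ∃ A : HybridCircuit G, HybridCircuit.Bounded d D b A ∧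
    ∀ φ r, ∀ χ ∈ HybridCircuit.branches A r (registerState X Y φ),
      ∃ c : ℂ, χ = c • registerState X Y (T φ)

variable {X : ι → Q} {Y : κ → Q} {D b : ℕ}

theorem Realizes.comp {d d' : ℕ}
    {T T' : ((ι → Bool) → (κ → Bool) → ℂ) → (ι → Bool) → (κ → Bool) → ℂ}
    (h : Realizes G X Y D b d T) (h' : Realizes G X Y D b d' T') :
    Realizes G X Y D b (d + d') fun φ => T' (T φ) := by
  obtain ⟨hT, A, hA, h⟩ := h
  obtain ⟨hT', A', hA', h'⟩ := h'
  refine ⟨fun c φ => by simp only [hT, hT'], A ++ A', hA.append hA', fun φ r χ hχ => ?_⟩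
  obtain ⟨r', ξ, hξ, hχ⟩ := HybridCircuit.mem_branches_append A A' r _ χ hχ
  obtain ⟨c, rfl⟩ := h φ r ξ hξ
  rw [← registerState_smul] at hχ
  obtain ⟨c', rfl⟩ := h' _ _ _ hχ
  refine ⟨c' * c, ?_⟩
  -- Homogeneity of `T'` lets the scalar of the first branch pass through the second operation.
  rw [hT', registerState_smul, smul_smul]

theorem realizes_single (hX : Function.Injective X) (hY : Function.Injective Y)
    (hXY : ∀ i j, X i ≠ Y j) (hQ : Fintype.card Q ≤ 2 ^ b) (hD : 1 ≤ D)
    (U : ι → Matrix.unitaryGroup Bool ℂ) (W : κ → Matrix.unitaryGroup Bool ℂ) :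
    Realizes G X Y D b 1 fun φ x =>
      tens (fun j => (W j).1) fun y => tens (fun i => (U i).1) (fun x' => φ x' y) x := by
  refine ⟨fun c φ => ?_, ?_⟩
  · funext x y
    have h1 : ∀ y, tens (fun i => (U i).1) (fun x' => (c • φ) x' y) x =
        c * tens (fun i => (U i).1) (fun x' => φ x' y) x := fun y =>
      congrFun (tens_smul (fun i => (U i).1) c fun x' => φ x' y) x
    simp only [h1]
    exact congrFun (tens_smul (fun j => (W j).1) c
      fun y => tens (fun i => (U i).1) (fun x' => φ x' y) x) y
  · let N : Q → Matrix.unitaryGroup Bool ℂ :=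
      Function.extend X U (Function.extend Y W fun _ => 1)
    obtain ⟨R, hR, hb⟩ := exists_round hQ (fun _ => ∅) ((QImpl.single (G := G) N).mono hD) ∅
    refine ⟨[R], hR, fun φ r χ hχ => ⟨1, ?_⟩⟩
    obtain ⟨_, _, _, _, _, hχ⟩ := hb _ _ _ _ hχ
    simp only [HybridCircuit.branches, Set.mem_singleton_iff] at hχ
    rw [hχ, one_smul]
    funext z
    simp only [projectOn, Finset.notMem_empty, false_imp_iff, implies_true, if_true]
    have hinj : Function.Injective (Sum.elim X Y) := hX.sumElim hY hXY
    have hNX : ∀ i, N (X i) = U i := fun i => hX.extend_apply _ _ _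
    have hNY : ∀ j, N (Y j) = W j := fun j => by
      simp only [N]
      rw [Function.extend_apply' _ _ _ fun ⟨i, hi⟩ => hXY i j hi, hY.extend_apply]
    rw [tens_apply_of_injective hinj]
    · have hr : ∀ q, q ∉ Set.range (Sum.elim X Y) ↔ q ∉ Set.range X ∧ q ∉ Set.range Y := by
        intro q
        rw [Set.Sum.elim_range, Set.mem_union, not_or]
      have key : ∀ y : ι ⊕ κ → Bool,
          registerState X Y φ (Function.extend (Sum.elim X Y) y z) =
          if ∀ q, q ∉ Set.range X → q ∉ Set.range Y → z q = false then
            φ (fun i => y (Sum.inl i)) (fun j => y (Sum.inr j)) else 0 := by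
        intro y
        have h1 : ∀ i, Function.extend (Sum.elim X Y) y z (X i) = y (Sum.inl i) := fun i =>
          hinj.extend_apply y z (Sum.inl i)
        have h2 : ∀ j, Function.extend (Sum.elim X Y) y z (Y j) = y (Sum.inr j) := fun j =>
          hinj.extend_apply y z (Sum.inr j)
        have h3 : (∀ q, q ∉ Set.range X → q ∉ Set.range Y →
            Function.extend (Sum.elim X Y) y z q = false) ↔
            ∀ q, q ∉ Set.range X → q ∉ Set.range Y → z q = false := by
          refine forall_congr' fun q => forall_congr' fun hx => forall_congr' fun hy => ?_
          rw [Function.extend_apply' _ _ _ ((hr q).2 ⟨hx, hy⟩)]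
        simp only [registerState, h1, h2, h3]
      simp only [key]
      simp only [registerState]
      split_ifs with hz
      · simp only [tens, Fintype.prod_sum_type, Sum.elim_inl, Sum.elim_inr, hNX, hNY]
        rw [← (Equiv.sumArrowEquivProdArrow ι κ Bool).symm.sum_comp, Fintype.sum_prod_type_right]
        refine Finset.sum_congr rfl fun y _ => ?_
        rw [Finset.mul_sum]
        refine Finset.sum_congr rfl fun x _ => ?_
        simp only [Equiv.sumArrowEquivProdArrow, Equiv.coe_fn_symm_mk, Sum.elim_inl, Sum.elim_inr]
        ring
      · simp
    · intro q hq
      rw [Set.Sum.elim_range, Set.mem_union, not_or] at hq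
      simp only [N]
      rw [Function.extend_apply' _ _ _ hq.1, Function.extend_apply' _ _ _ hq.2]
      rfl

/-- A phase circuit, applied to two registers. -/
theorem IsEncoder.realizes {α : Type} [Fintype α] {anc chk : α → Q} {V L : (Q → Bool) → Q → Bool}
    (h : IsEncoder anc chk V) {D₁ D₂ : ℕ} (hQ : Fintype.card Q ≤ 2 ^ b)
    (hV : QImpl G D₁ fun _ ψ x => ψ (V x)) (hLL : ∀ x, L (L x) = x)
    (hL : QImpl G D₂ fun _ ψ x => ψ (L x)) (hD₁ : 1 + D₁ ≤ D) (hD₂ : 3 + 2 * D₂ ≤ D)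
    (hX : ∀ i a, anc a ≠ X i ∧ chk a ≠ X i) (hY : ∀ j a, anc a ≠ Y j ∧ chk a ≠ Y j)
    (ω : Q → ℝ) (P : (ι → Bool) → (κ → Bool) → ℂ)
    (hP : ∀ y, (∀ a, y (chk a) = false) → (∀ a, V y (chk a) = false) →
      ∏ q, phase (ω q) (L y q) = P (fun i => y (X i)) (fun j => y (Y j))) :
    Realizes G X Y D b 3 fun φ x y => P x y * φ x y := by
  refine ⟨fun c φ => ?_, ?_⟩
  · funext x y
    simp only [Pi.smul_apply, smul_eq_mul]
    ring
  · obtain ⟨A, hA, hA'⟩ := h.exists_phase_circuit hQ hV hLL hL hD₁ hD₂ ω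
      (fun z => P (fun i => z (X i)) (fun j => z (Y j))) (fun y h₁ h₂ => by
        rw [hP y h₁ h₂]
        have hx : ∀ i, X i ∉ Finset.univ.image anc := fun i => by simpa using fun a => (hX i a).1
        have hy : ∀ j, Y j ∉ Finset.univ.image anc := fun j => by simpa using fun a => (hY j a).1
        simp only [clear, hx, hy, if_false])
    refine ⟨A, hA, fun φ r χ hχ => ?_⟩
    have hsupp : ∀ z, (∃ a, z (anc a) = true ∨ z (chk a) = true) → registerState X Y φ z = 0 := by
      intro z hz
      simp only [registerState]
      rw [if_neg]
      intro hc
      obtain ⟨a, ha | ha⟩ := hz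
      · rw [hc] at ha
        · simp at ha
        · rintro ⟨i, hi⟩; exact (hX i a).1 hi.symm
        · rintro ⟨i, hi⟩; exact (hY i a).1 hi.symm
      · rw [hc] at ha
        · simp at ha
        · rintro ⟨i, hi⟩; exact (hX i a).2 hi.symm
        · rintro ⟨i, hi⟩; exact (hY i a).2 hi.symm
    obtain ⟨c, rfl⟩ := hA' _ hsupp r χ hχ
    refine ⟨c, ?_⟩
    congr 1
    funext z
    simp only [registerState]
    split_ifs <;> simp

end realizes

theorem addMap_apply_bool {Q ι : Type} {a b : ι → Q} (hb : Function.Injective b) (r : ι → Bool)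
    (x : Q → Bool) (i : ι) :
    addMap a b {p | r p = true} x (b i) = xor (x (b i)) (r i && x (a i)) := by
  cases hr : r i
  · rw [addMap_apply_of_ne]
    · simp
    · intro j hj h
      rw [hb h] at hj
      simp [hr] at hj
  · rw [addMap_apply hb.injOn x (i := i) hr]
    simp

/-! ### The encoder on the grid -/

namespace Grid

variable {n m : ℕ}

/-- The qubits of the grid: in row `i`, the qubits `site i j 1, …, site i j 4` form the `j`-th
cell, and `site i j 0` is the last qubit of the cell before it. -/
def site (i : Fin n) (j : Fin m) (s : Fin 5) : Fin n × Fin (4 * m + 1) :=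
  (i, ⟨4 * j + s, by omega⟩)

theorem site_eq_iff {i i' : Fin n} {j j' : Fin m} {s s' : Fin 5} :
    site i j s = site i' j' s' ↔ i.1 = i'.1 ∧ 4 * j.1 + s.1 = 4 * j'.1 + s'.1 := by
  simp [site, Prod.ext_iff, Fin.ext_iff]

theorem site_injective (s : Fin 5) :
    Function.Injective fun p : Fin n × Fin m => site p.1 p.2 s := by
  intro p p' h
  simp only [site_eq_iff] at h
  exact Prod.ext (Fin.ext h.1) (Fin.ext (by omega))

/-- The row before row `i`. -/
def prevRow (i : Fin n) : Fin n := ⟨i - 1, by omega⟩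

theorem adj_site_succ (i : Fin n) (j : Fin m) {s s' : Fin 5} (h : s.1 + 1 = s'.1) :
    (gridGraph n (4 * m + 1)).Adj (site i j s) (site i j s') := by
  rw [SimpleGraph.boxProd_adj]
  right
  rw [SimpleGraph.pathGraph_adj]
  exact ⟨Or.inl (by simp only [site]; omega), rfl⟩

theorem adj_prevRow {i : Fin n} (hi : i.1 ≠ 0) (j : Fin m) (s : Fin 5) :
    (gridGraph n (4 * m + 1)).Adj (site (prevRow i) j s) (site i j s) := by
  rw [SimpleGraph.boxProd_adj]
  left
  rw [SimpleGraph.pathGraph_adj]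
  exact ⟨Or.inl (by simp only [site, prevRow]; omega), rfl⟩

/-- Adding the bits at position `s` of the cells in `r` to the bits at position `t`. -/
noncomputable def rowAdd (s t : Fin 5) (r : Fin n × Fin m → Bool) :=
  addMap (fun p : Fin n × Fin m => site p.1 p.2 s) (fun p => site p.1 p.2 t) {p | r p = true}

/-- Adding the bits at position 2 in the row before to the bits at position 1. -/
noncomputable def colAdd (r : Fin n × Fin m → Bool) :=
  addMap (fun p : Fin n × Fin m => site (prevRow p.1) p.2 2) (fun p => site p.1 p.2 1)
    {p | r p = true}

/-- Columns are compared modulo 4, as positions 0 and 4 of consecutive cells coincide. The summand 4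
keeps the natural subtraction from truncating. -/
theorem site_ne_site {s t : Fin 5} (h : (s.1 + 4 - t.1) % 4 ≠ 0) (i i' : Fin n) (j j' : Fin m) :
    site i j s ≠ site i' j' t := by
  rw [Ne, site_eq_iff]
  omega

theorem qimpl_rowAdd_one (s t : Fin 5) (h : s.1 + 1 = t.1 ∨ t.1 + 1 = s.1)
    (r : Fin n × Fin m → Bool) :
    QImpl (gridGraph n (4 * m + 1)) 1 fun _ ψ x => ψ (rowAdd s t r x) := by
  refine QImpl.cnot _ _ _ (fun p _ => ?_) (site_injective s).injOn (site_injective t).injOn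
    fun p _ p' _ => site_ne_site (by omega) _ _ _ _
  rcases h with h | h
  · exact adj_site_succ _ _ h
  · exact (adj_site_succ _ _ h).symm

theorem qimpl_rowAdd_trans {s u t : Fin 5} {D D' : ℕ} {r : Fin n × Fin m → Bool}
    (h : QImpl (gridGraph n (4 * m + 1)) D fun _ ψ x => ψ (rowAdd s u r x))
    (h' : QImpl (gridGraph n (4 * m + 1)) D' fun _ ψ x => ψ (rowAdd u t r x))
    (h₁ : (s.1 + 4 - u.1) % 4 ≠ 0) (h₂ : (s.1 + 4 - t.1) % 4 ≠ 0) (h₃ : (u.1 + 4 - t.1) % 4 ≠ 0) :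
    QImpl (gridGraph n (4 * m + 1)) (2 * D + 2 * D') fun _ ψ x => ψ (rowAdd s t r x) :=
  QImpl.cnot_trans h h' (site_injective u).injOn (site_injective t).injOn
    (fun _ _ _ _ => site_ne_site h₁ _ _ _ _) (fun _ _ _ _ => site_ne_site h₂ _ _ _ _)
    fun _ _ _ _ => site_ne_site h₃ _ _ _ _

/-- The route leads down from position 2 of the row above to position 2 of the row itself, then left
to position 1. Among rows of one parity, the rows of the controls and those of the intermediate
qubits alternate, so the gates of each layer are disjoint. -/
theorem qimpl_colAdd (b : ℕ) :
    QImpl (gridGraph n (4 * m + 1)) 4 fun _ ψ x =>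
      ψ (colAdd (fun p => decide (p.1.1 ≠ 0 ∧ p.1.1 % 2 = b)) x) := by
  refine QImpl.cnot_trans (D := 1) (D' := 1) (k := fun p => site p.1 p.2 2)
    (QImpl.cnot _ _ _ ?_ ?_ ?_ ?_) (QImpl.cnot _ _ _ ?_ ?_ ?_ ?_) ?_ ?_ ?_ ?_ ?_
  · intro p hp
    simp only [Set.mem_ofPred_eq, decide_eq_true_eq] at hp
    exact adj_prevRow hp.1 _ _
  · intro p hp p' hp' h
    simp only [Set.mem_ofPred_eq, decide_eq_true_eq] at hp hp'
    simp only [site_eq_iff, prevRow] at h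
    exact Prod.ext (Fin.ext (by omega)) (Fin.ext (by omega))
  · exact (site_injective 2).injOn
  · intro p hp p' hp'
    simp only [Set.mem_ofPred_eq, decide_eq_true_eq] at hp hp'
    simp only [ne_eq, site_eq_iff, prevRow]
    omega
  · intro p _
    exact (adj_site_succ _ _ (by decide)).symm
  · exact (site_injective 2).injOn
  · exact (site_injective 1).injOn
  · exact fun _ _ _ _ => site_ne_site (by decide) _ _ _ _
  · exact (site_injective 2).injOn
  · exact (site_injective 1).injOn
  · intro p hp p' hp'
    simp only [Set.mem_ofPred_eq, decide_eq_true_eq] at hp hp'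
    simp only [ne_eq, site_eq_iff, prevRow]
    omega
  · exact fun _ _ _ _ => site_ne_site (by decide) _ _ _ _
  · exact fun _ _ _ _ => site_ne_site (by decide) _ _ _ _

theorem rowAdd_apply (s t : Fin 5) (r : Fin n × Fin m → Bool) (x : Fin n × Fin (4 * m + 1) → Bool)
    (i : Fin n) (j : Fin m) :
    rowAdd s t r x (site i j t) = xor (x (site i j t)) (r (i, j) && x (site i j s)) :=
  addMap_apply_bool (site_injective t) r x (i, j)

theorem colAdd_apply (r : Fin n × Fin m → Bool) (x : Fin n × Fin (4 * m + 1) → Bool)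
    (i : Fin n) (j : Fin m) :
    colAdd r x (site i j 1) = xor (x (site i j 1)) (r (i, j) && x (site (prevRow i) j 2)) :=
  addMap_apply_bool (site_injective 1) r x (i, j)

theorem rowAdd_apply_of_ne {s t : Fin 5} {r : Fin n × Fin m → Bool}
    {x : Fin n × Fin (4 * m + 1) → Bool} {q : Fin n × Fin (4 * m + 1)}
    (h : ∀ i j, r (i, j) = true → site i j t ≠ q) : rowAdd s t r x q = x q :=
  addMap_apply_of_ne x fun p hp => h p.1 p.2 hp

theorem colAdd_apply_of_ne {r : Fin n × Fin m → Bool}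
    {x : Fin n × Fin (4 * m + 1) → Bool} {q : Fin n × Fin (4 * m + 1)}
    (h : ∀ i j, r (i, j) = true → site i j 1 ≠ q) : colAdd r x q = x q :=
  addMap_apply_of_ne x fun p hp => h p.1 p.2 hp

/-- The bits at position 1 check that the bits at position 2 agree with those in the row before,
the bits at position 3 check that the bit at position 4 is the sum of the bits at position 0
(if `ρ`) and at position 2 (if `κ`). -/
noncomputable def encodeMap (ρ κ : Fin n × Fin m → Bool) (x : Fin n × Fin (4 * m + 1) → Bool) :
    Fin n × Fin (4 * m + 1) → Bool :=
  rowAdd 2 1 (fun p => decide (p.1.1 ≠ 0)) <|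
  colAdd (fun p => decide (p.1.1 ≠ 0 ∧ p.1.1 % 2 = 0)) <|
  colAdd (fun p => decide (p.1.1 ≠ 0 ∧ p.1.1 % 2 = 1)) <|
  rowAdd 4 3 (fun _ => true) <| rowAdd 0 3 ρ <| rowAdd 2 3 κ x

theorem qimpl_encodeMap (ρ κ : Fin n × Fin m → Bool) :
    QImpl (gridGraph n (4 * m + 1)) 21 fun _ ψ x => ψ (encodeMap ρ κ x) := by
  have h₁ := qimpl_rowAdd_one (n := n) (m := m) 2 1 (by decide) (fun p => decide (p.1.1 ≠ 0))
  have h₂ := qimpl_colAdd (n := n) (m := m) 0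
  have h₃ := qimpl_colAdd (n := n) (m := m) 1
  have h₄ := qimpl_rowAdd_one (n := n) (m := m) 4 3 (by decide) (fun _ => true)
  -- CNOT gates at distances 1, 2, 3 take depths 1, 4, 10. The total is `1 + 4 + 4 + 1 + 10 + 1 =
  -- 21`.
  have h₅ : QImpl (gridGraph n (4 * m + 1)) 10 fun _ ψ x => ψ (rowAdd 0 3 ρ x) :=
    qimpl_rowAdd_trans (qimpl_rowAdd_one 0 1 (by decide) ρ)
      (qimpl_rowAdd_trans (qimpl_rowAdd_one 1 2 (by decide) ρ) (qimpl_rowAdd_one 2 3 (by decide) ρ)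
        (by decide) (by decide) (by decide)) (by decide) (by decide) (by decide)
  have h₆ := qimpl_rowAdd_one 2 3 (by decide) κ
  exact ((((h₁.comp h₂).comp h₃).comp h₄).comp h₅).comp h₆

theorem encodeMap_apply_three (ρ κ : Fin n × Fin m → Bool) (x : Fin n × Fin (4 * m + 1) → Bool)
    (i : Fin n) (j : Fin m) :
    encodeMap ρ κ x (site i j 3) = xor (xor (xor (x (site i j 3)) (κ (i, j) && x (site i j 2)))
      (ρ (i, j) && x (site i j 0))) (x (site i j 4)) := by
  unfold encodeMap
  rw [rowAdd_apply_of_ne fun _ _ _ => site_ne_site (by decide) _ _ _ _,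
    colAdd_apply_of_ne fun _ _ _ => site_ne_site (by decide) _ _ _ _,
    colAdd_apply_of_ne fun _ _ _ => site_ne_site (by decide) _ _ _ _,
    rowAdd_apply, rowAdd_apply, rowAdd_apply,
    rowAdd_apply_of_ne fun _ _ _ => site_ne_site (by decide) _ _ _ _,
    rowAdd_apply_of_ne fun _ _ _ => site_ne_site (by decide) _ _ _ _,
    rowAdd_apply_of_ne fun _ _ _ => site_ne_site (by decide) _ _ _ _, Bool.true_and]

theorem encodeMap_apply_one (ρ κ : Fin n × Fin m → Bool) (x : Fin n × Fin (4 * m + 1) → Bool)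
    {i : Fin n} (hi : i.1 ≠ 0) (j : Fin m) :
    encodeMap ρ κ x (site i j 1) =
      xor (xor (x (site i j 1)) (x (site (prevRow i) j 2))) (x (site i j 2)) := by
  have h3 : ∀ (s : Fin 5) r (x : Fin n × Fin (4 * m + 1) → Bool) (i : Fin n) (j : Fin m),
      rowAdd s 3 r x (site i j 2) = x (site i j 2) := fun _ _ _ _ _ =>
    rowAdd_apply_of_ne fun _ _ _ => site_ne_site (by decide) _ _ _ _
  have h3' : ∀ (s : Fin 5) r (x : Fin n × Fin (4 * m + 1) → Bool) (i : Fin n) (j : Fin m),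
      rowAdd s 3 r x (site i j 1) = x (site i j 1) := fun _ _ _ _ _ =>
    rowAdd_apply_of_ne fun _ _ _ => site_ne_site (by decide) _ _ _ _
  have h1 : ∀ r (x : Fin n × Fin (4 * m + 1) → Bool) (i : Fin n) (j : Fin m),
      colAdd r x (site i j 2) = x (site i j 2) := fun _ _ _ _ =>
    colAdd_apply_of_ne fun _ _ _ => site_ne_site (by decide) _ _ _ _
  unfold encodeMap
  simp only [rowAdd_apply, colAdd_apply, h3, h3', h1]
  rcases Nat.mod_two_eq_zero_or_one i.1 with h | h <;> simp [hi, h]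

theorem encodeMap_apply_of_ne (ρ κ : Fin n × Fin m → Bool) (x : Fin n × Fin (4 * m + 1) → Bool)
    {q : Fin n × Fin (4 * m + 1)} (h₁ : ∀ (i : Fin n) (j : Fin m), i.1 ≠ 0 → site i j 1 ≠ q)
    (h₃ : ∀ (i : Fin n) (j : Fin m), site i j 3 ≠ q) : encodeMap ρ κ x q = x q := by
  unfold encodeMap
  rw [rowAdd_apply_of_ne fun i j h => h₁ i j (by simpa using h),
    colAdd_apply_of_ne fun i j h => h₁ i j (of_decide_eq_true h).1,
    colAdd_apply_of_ne fun i j h => h₁ i j (of_decide_eq_true h).1,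
    rowAdd_apply_of_ne fun i j _ => h₃ i j, rowAdd_apply_of_ne fun i j _ => h₃ i j,
    rowAdd_apply_of_ne fun i j _ => h₃ i j]

theorem encodeMap_apply_site (ρ κ : Fin n × Fin m → Bool) (x : Fin n × Fin (4 * m + 1) → Bool)
    (i : Fin n) (j : Fin m) {s : Fin 5} (hs : s.1 % 2 = 0) :
    encodeMap ρ κ x (site i j s) = x (site i j s) :=
  encodeMap_apply_of_ne ρ κ x
    (fun _ _ _ => site_ne_site (by have : ((1 : Fin 5) : ℕ) = 1 := rfl; omega) _ _ _ _)
    fun _ _ => site_ne_site (by have : ((3 : Fin 5) : ℕ) = 3 := rfl; omega) _ _ _ _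

/-- Only odd positions change, by amounts that depend on even positions only. -/
theorem encodeMap_encodeMap (ρ κ : Fin n × Fin m → Bool) (x : Fin n × Fin (4 * m + 1) → Bool) :
    encodeMap ρ κ (encodeMap ρ κ x) = x := by
  funext q
  by_cases h₃ : ∃ (i : Fin n) (j : Fin m), site i j 3 = q
  · obtain ⟨i, j, rfl⟩ := h₃
    have h0 := encodeMap_apply_site ρ κ x i j (s := 0) rfl
    have h2 := encodeMap_apply_site ρ κ x i j (s := 2) rfl
    have h4 := encodeMap_apply_site ρ κ x i j (s := 4) rfl
    rw [encodeMap_apply_three, encodeMap_apply_three, h0, h2, h4]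
    cases x (site i j 3) <;> cases (κ (i, j) && x (site i j 2)) <;>
      cases (ρ (i, j) && x (site i j 0)) <;> cases x (site i j 4) <;> rfl
  · by_cases h₁ : ∃ (i : Fin n) (j : Fin m), i.1 ≠ 0 ∧ site i j 1 = q
    · obtain ⟨i, j, hi, rfl⟩ := h₁
      have h2 := encodeMap_apply_site ρ κ x i j (s := 2) rfl
      have h2' := encodeMap_apply_site ρ κ x (prevRow i) j (s := 2) rfl
      rw [encodeMap_apply_one _ _ _ hi, encodeMap_apply_one _ _ _ hi, h2, h2']
      cases x (site i j 1) <;> cases x (site (prevRow i) j 2) <;> cases x (site i j 2) <;> rfl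
    · push Not at h₁ h₃
      rw [encodeMap_apply_of_ne _ _ _ h₁ h₃, encodeMap_apply_of_ne _ _ _ h₁ h₃]

/-- The ancillas: the bits at position 4, and those at position 2 outside the first row. -/
def anc : (Fin n × Fin m) ⊕ {p : Fin n × Fin m // p.1.1 ≠ 0} → Fin n × Fin (4 * m + 1) :=
  Sum.elim (fun p => site p.1 p.2 4) fun p => site p.1.1 p.1.2 2

/-- The check bits. -/
def chk : (Fin n × Fin m) ⊕ {p : Fin n × Fin m // p.1.1 ≠ 0} → Fin n × Fin (4 * m + 1) :=
  Sum.elim (fun p => site p.1 p.2 3) fun p => site p.1.1 p.1.2 1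

/-- Functions of the bits that are sums of data bits and check bits. -/
def IsSum {Q α : Type} (anc chk : α → Q) (V : (Q → Bool) → Q → Bool) (f : (Q → Bool) → Bool) :
    Prop :=
  ∃ S E : Finset Q, (∀ q ∈ S, ∀ a', anc a' ≠ q ∧ chk a' ≠ q) ∧
    (∀ q ∈ E, ∃ a', chk a' = q) ∧ ∀ x, (∀ c, x (chk c) = false) →
      f x = xor (parity S x) (parity E (V x))

section IsSum

variable {Q α : Type} {anc chk : α → Q} {V : (Q → Bool) → Q → Bool} {f g : (Q → Bool) → Bool}

theorem IsSum.add (hf : IsSum anc chk V f) (hg : IsSum anc chk V g) :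
    IsSum anc chk V fun x => Bool.xor (f x) (g x) := by
  classical
  obtain ⟨S, E, hS, hE, hf⟩ := hf
  obtain ⟨S', E', hS', hE', hg⟩ := hg
  refine ⟨symmDiff S S', symmDiff E E', fun q hq => ?_, fun q hq => ?_, fun x hx => ?_⟩
  · rcases Finset.mem_symmDiff.1 hq with h | h
    exacts [hS q h.1, hS' q h.1]
  · rcases Finset.mem_symmDiff.1 hq with h | h
    exacts [hE q h.1, hE' q h.1]
  · simp only [hf x hx, hg x hx, parity_symmDiff]
    cases parity S x <;> cases parity S' x <;> cases parity E (V x) <;> cases parity E' (V x) <;>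
      rfl

theorem IsSum.zero : IsSum anc chk V fun _ => false :=
  ⟨∅, ∅, by simp, by simp, fun x _ => by simp⟩

theorem IsSum.bool_smul (b : Bool) (hf : IsSum anc chk V f) :
    IsSum anc chk V fun x => b && f x := by
  cases b
  · exact IsSum.zero
  · simpa using hf

theorem IsSum.data {q : Q} (hq : ∀ a, anc a ≠ q ∧ chk a ≠ q) : IsSum anc chk V fun x => x q :=
  ⟨{q}, ∅, by simpa using hq, by simp, fun x _ => by simp⟩

theorem IsSum.check (c : α) : IsSum anc chk V fun x => V x (chk c) :=
  ⟨∅, {chk c}, by simp, by simp, fun x _ => by simp⟩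

theorem IsSum.congr (hf : IsSum anc chk V f) (h : ∀ x, (∀ c, x (chk c) = false) → g x = f x) :
    IsSum anc chk V g := by
  obtain ⟨S, E, hS, hE, hf⟩ := hf
  exact ⟨S, E, hS, hE, fun x hx => (h x hx).trans (hf x hx)⟩

end IsSum

/-- Each bit of a column is the one above it plus a check bit, and the topmost one belongs to the
auxiliary register; the sum telescopes. -/
theorem isSum_two (ρ κ : Fin n × Fin m → Bool) (i : Fin n) (j : Fin m) :
    IsSum anc chk (encodeMap ρ κ) fun x => x (site i j 2) := by
  obtain ⟨k, hk⟩ := i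
  induction k with
  | zero =>
    refine IsSum.data ?_
    rintro (⟨i', j'⟩ | ⟨⟨i', j'⟩, hi⟩)
    · exact ⟨site_ne_site (by decide) _ _ _ _, site_ne_site (by decide) _ _ _ _⟩
    · refine ⟨?_, site_ne_site (by decide) _ _ _ _⟩
      simp only [anc, Sum.elim_inr, ne_eq, site_eq_iff]
      exact fun h => hi h.1
  | succ k ih =>
    have hne : (⟨k + 1, hk⟩ : Fin n).1 ≠ 0 := Nat.succ_ne_zero k
    refine ((ih (by omega)).add (IsSum.check (Sum.inr ⟨(⟨k + 1, hk⟩, j), hne⟩))).congr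
      fun x hx => ?_
    have hc := hx (Sum.inr ⟨(⟨k + 1, hk⟩, j), hne⟩)
    simp only [chk, Sum.elim_inr] at hc ⊢
    rw [encodeMap_apply_one _ _ _ hne, hc]
    have : prevRow (⟨k + 1, hk⟩ : Fin n) = ⟨k, by omega⟩ := rfl
    rw [this]
    cases x (site ⟨k, by omega⟩ j 2) <;> cases x (site ⟨k + 1, hk⟩ j 2) <;> rfl

/-- The row recursion is unrolled to the left: position 0 of a cell is position 4 of the cell before
it, or a data qubit in the first cell. -/
theorem isSum_four (ρ κ : Fin n × Fin m → Bool) (i : Fin n) (j : Fin m) :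
    IsSum anc chk (encodeMap ρ κ) fun x => x (site i j 4) := by
  obtain ⟨k, hk⟩ := j
  have step : ∀ j : Fin m, (IsSum anc chk (encodeMap ρ κ) fun x => x (site i j 0)) →
      IsSum anc chk (encodeMap ρ κ) fun x => x (site i j 4) := by
    intro j h
    refine (((h.bool_smul (ρ (i, j))).add ((isSum_two ρ κ i j).bool_smul (κ (i, j)))).add
      (IsSum.check (Sum.inl (i, j)))).congr fun x hx => ?_
    have hc := hx (Sum.inl (i, j))
    simp only [chk, Sum.elim_inl] at hc ⊢
    rw [encodeMap_apply_three, hc]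
    cases (ρ (i, j) && x (site i j 0)) <;> cases (κ (i, j) && x (site i j 2)) <;>
      cases x (site i j 4) <;> rfl
  induction k with
  | zero =>
    refine step _ (IsSum.data ?_)
    rintro (⟨i', j'⟩ | ⟨⟨i', j'⟩, hi⟩)
    · refine ⟨?_, site_ne_site (by decide) _ _ _ _⟩
      simp only [anc, Sum.elim_inl, ne_eq, site_eq_iff]
      have : ((4 : Fin 5) : ℕ) = 4 := rfl
      have : ((0 : Fin 5) : ℕ) = 0 := rfl
      omega
    · exact ⟨site_ne_site (by decide) _ _ _ _, site_ne_site (by decide) _ _ _ _⟩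
  | succ k ih =>
    refine step _ ?_
    have : site i (⟨k + 1, hk⟩ : Fin m) 0 = site i ⟨k, by omega⟩ 4 := by
      rw [site_eq_iff]
      exact ⟨rfl, by simp; omega⟩
    rw [this]
    exact ih _

theorem isEncoder_encodeMap (ρ κ : Fin n × Fin m → Bool) :
    IsEncoder anc chk (encodeMap ρ κ) where
  anc_injective := by
    refine (site_injective 4).sumElim ((site_injective 2).comp Subtype.val_injective) ?_
    exact fun _ _ => site_ne_site (by decide) _ _ _ _
  anc_ne_chk := by
    rintro (_ | _) (_ | _) <;> exact site_ne_site (by decide) _ _ _ _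
  involutive := encodeMap_encodeMap ρ κ
  apply_of_ne x q h := encodeMap_apply_of_ne ρ κ x
    (fun i j hi => h (Sum.inr ⟨(i, j), hi⟩)) fun i j => h (Sum.inl (i, j))
  determined := by
    rintro (⟨i, j⟩ | ⟨⟨i, j⟩, _⟩)
    · exact isSum_four ρ κ i j
    · exact isSum_two ρ κ i j

end Grid

/-! ### Diagonal operations on the data and auxiliary registers of the grid -/

namespace Grid

variable {n m : ℕ}

/-- The data register: the first column. -/
def dataSite (i : Fin n) : Fin n × Fin (4 * m + 1) := (i, 0)

/-- The auxiliary register: the bits at position 2 in the first row. -/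
def auxSite (hn : 0 < n) (j : Fin m) : Fin n × Fin (4 * m + 1) := site ⟨0, hn⟩ j 2

theorem dataSite_injective : Function.Injective (dataSite (n := n) (m := m)) := fun i i' h => by
  simpa [dataSite] using h

theorem auxSite_injective (hn : 0 < n) :
    Function.Injective (auxSite (m := m) hn) := fun j j' h => by
  simp only [auxSite, site_eq_iff] at h
  exact Fin.ext (by omega)

theorem site_ne_dataSite (i i' : Fin n) (j : Fin m) {s : Fin 5} (hs : s.1 ≠ 0) :
    site i j s ≠ dataSite i' := by
  simp only [site, dataSite, ne_eq, Prod.mk.injEq, Fin.ext_iff, Fin.val_zero]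
  omega

theorem dataSite_ne_auxSite (hn : 0 < n) (i : Fin n) (j : Fin m) : dataSite i ≠ auxSite hn j :=
  (site_ne_dataSite _ _ _ (by decide)).symm

theorem rowAdd_rowAdd {s t : Fin 5} (h : (s.1 + 4 - t.1) % 4 ≠ 0) (r : Fin n × Fin m → Bool)
    (x : Fin n × Fin (4 * m + 1) → Bool) : rowAdd s t r (rowAdd s t r x) = x := by
  funext q
  by_cases hq : ∃ (i : Fin n) (j : Fin m), site i j t = q
  · obtain ⟨i, j, rfl⟩ := hq
    rw [rowAdd_apply, rowAdd_apply, rowAdd_apply_of_ne fun i' j' _ =>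
      (site_ne_site h _ _ _ _).symm]
    cases x (site i j t) <;> cases (r (i, j) && x (site i j s)) <;> rfl
  · push Not at hq
    rw [rowAdd_apply_of_ne fun i j _ => hq i j, rowAdd_apply_of_ne fun i j _ => hq i j]

theorem xor_eq_false {a b : Bool} : xor a b = false ↔ a = b := by
  cases a <;> cases b <;> simp

/-- Phases that depend on bits `R i j` which are computed from left to right in each row. -/
theorem realizes_phases (hn : 0 < n) {b : ℕ} (hQ : Fintype.card (Fin n × Fin (4 * m + 1)) ≤ 2 ^ b)
    (ρ κ lam : Fin n × Fin m → Bool) (θ : Fin n × Fin m → ℝ)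
    (P : (Fin n → Bool) → (Fin m → Bool) → ℂ)
    (hP : ∀ (x : Fin n → Bool) (g : Fin m → Bool) (R : Fin n → Fin m → Bool),
      (∀ i (j : Fin m), j.1 = 0 → R i j = xor (κ (i, j) && g j) (ρ (i, j) && x i)) →
      (∀ i (j j' : Fin m), j'.1 = j.1 + 1 →
        R i j' = xor (κ (i, j') && g j') (ρ (i, j') && R i j)) →
      ∏ p : Fin n × Fin m, phase (θ p) (xor (R p.1 p.2) (lam p && g p.2)) = P x g) :
    Realizes (gridGraph n (4 * m + 1)) dataSite (auxSite (m := m) hn) 30 b 3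
      fun φ x g => P x g * φ x g := by
  have hL : QImpl (gridGraph n (4 * m + 1)) 4 fun _ ψ x => ψ (rowAdd 2 4 lam x) :=
    qimpl_rowAdd_trans (qimpl_rowAdd_one 2 3 (by decide) lam) (qimpl_rowAdd_one 3 4 (by decide) lam)
      (by decide) (by decide) (by decide)
  -- The depth bound 30 has to cover `1 + 21` for the encoding round and `3 + 2 * 4` for the round
  -- of the phases.
  refine (isEncoder_encodeMap ρ κ).realizes hQ (qimpl_encodeMap ρ κ) (L := rowAdd 2 4 lam)
    (fun x => rowAdd_rowAdd (by decide) lam x) hL (by norm_num) (by norm_num) ?_ ?_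
    (Function.extend (fun p : Fin n × Fin m => site p.1 p.2 4) θ 0) P ?_
  · rintro i (_ | _) <;>
      exact ⟨site_ne_dataSite _ _ _ (by decide), site_ne_dataSite _ _ _ (by decide)⟩
  · rintro j (_ | ⟨⟨i, j'⟩, hi⟩)
    · exact ⟨site_ne_site (by decide) _ _ _ _, site_ne_site (by decide) _ _ _ _⟩
    · refine ⟨?_, site_ne_site (by decide) _ _ _ _⟩
      simp only [anc, Sum.elim_inr, auxSite, ne_eq, site_eq_iff]
      exact fun h => hi h.1
  · intro y hy hVy
    -- The checks at position 1 say that every column holds copies of its auxiliary bit.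
    have hcol : ∀ (i : Fin n) (j : Fin m), y (site i j 2) = y (auxSite hn j) := by
      rintro ⟨k, hk⟩ j
      induction k with
      | zero => rfl
      | succ k ih =>
        have hne : (⟨k + 1, hk⟩ : Fin n).1 ≠ 0 := Nat.succ_ne_zero k
        have h₁ := hy (Sum.inr ⟨(⟨k + 1, hk⟩, j), hne⟩)
        have h₂ := hVy (Sum.inr ⟨(⟨k + 1, hk⟩, j), hne⟩)
        simp only [chk, Sum.elim_inr] at h₁ h₂
        rw [encodeMap_apply_one _ _ _ hne, h₁, Bool.false_xor, xor_eq_false] at h₂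
        rw [← h₂]
        exact ih _
    -- The checks at position 3 are the recursion that defines `R`.
    have hrow : ∀ (i : Fin n) (j : Fin m), y (site i j 4) =
        xor (κ (i, j) && y (auxSite hn j)) (ρ (i, j) && y (site i j 0)) := by
      intro i j
      have h₁ := hy (Sum.inl (i, j))
      have h₂ := hVy (Sum.inl (i, j))
      simp only [chk, Sum.elim_inl] at h₁ h₂
      rw [encodeMap_apply_three, h₁, Bool.false_xor, xor_eq_false, hcol] at h₂
      exact h₂.symm
    rw [← hP (fun i => y (dataSite i)) (fun j => y (auxSite hn j)) (fun i j => y (site i j 4))]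
    · symm
      refine Fintype.prod_of_injective _ (site_injective 4) _ _ ?_ ?_
      · intro q hq
        rw [Function.extend_apply' _ _ _ hq]
        simp
      · intro p
        rw [(site_injective 4).extend_apply, rowAdd_apply, hcol]
    · intro i j hj
      have : site i j 0 = dataSite i := by simp [site, dataSite, hj]
      rw [hrow, this]
    · intro i j j' hj
      have : site i j' 0 = site i j 4 := by
        rw [site_eq_iff]
        exact ⟨rfl, by simp; omega⟩
      rw [hrow, this]

/-- Phases that depend on the sum of a data bit and an auxiliary bit. -/
theorem realizes_xor_phases (hn : 0 < n) {b : ℕ}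
    (hQ : Fintype.card (Fin n × Fin (4 * m + 1)) ≤ 2 ^ b) (β : Fin m → ℝ) :
    Realizes (gridGraph n (4 * m + 1)) dataSite (auxSite (m := m) hn) 30 b 3
      fun φ x g => (∏ j, ∏ i, phase (β j) (xor (x i) (g j))) * φ x g := by
  -- With `ρ` on and `κ` off the data bit is copied along its row; `lam` adds the auxiliary bit only
  -- while the phases are applied.
  refine realizes_phases hn hQ (fun _ => true) (fun _ => false) (fun _ => true) (fun p => β p.2)
    (fun x g => ∏ j, ∏ i, phase (β j) (xor (x i) (g j))) ?_
  intro x g R h₀ h₁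
  have hR : ∀ i j, R i j = x i := by
    rintro i ⟨k, hk⟩
    induction k with
    | zero => rw [h₀ _ _ rfl]; simp
    | succ k ih => rw [h₁ i ⟨k, by omega⟩ _ rfl, ih]; simp
  simp only [hR, Bool.true_and]
  rw [Fintype.prod_prod_type, Finset.prod_comm]

/-- Phases that depend on parities of auxiliary bits, one for each row. -/
theorem realizes_parity_phases (hn : 0 < n) (hm : 0 < m) {b : ℕ}
    (hQ : Fintype.card (Fin n × Fin (4 * m + 1)) ≤ 2 ^ b) (S : Fin n → Fin m → Bool) (α : ℝ) :
    Realizes (gridGraph n (4 * m + 1)) dataSite (auxSite (m := m) hn) 30 b 3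
      fun φ x g =>
        (∏ i, phase α (parity (Finset.univ.filter fun j => S i j = true) g)) * φ x g := by
  -- Switching `ρ` off in the first cell disconnects the data bit. Row `i` then accumulates the
  -- parity over `S i`, which is complete in the last cell, the only one that gets a phase.
  refine realizes_phases hn hQ (fun p => decide (p.2.1 ≠ 0)) (fun p => S p.1 p.2) (fun _ => false)
    (fun p => if p.2.1 + 1 = m then α else 0)
    (fun _ g => ∏ i, phase α (parity (Finset.univ.filter fun j => S i j = true) g)) ?_
  intro x g R h₀ h₁
  have hsing : ∀ i (j : Fin m), (S i j && g j) =
      parity (Finset.univ.filter fun j' => S i j' = true ∧ j' = j) g := by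
    intro i j
    cases h : S i j
    · have : (Finset.univ.filter fun j' => S i j' = true ∧ j' = j) = ∅ := by
        ext j'
        simp only [Finset.mem_filter, Finset.mem_univ, true_and, Finset.notMem_empty, iff_false]
        rintro ⟨h', rfl⟩
        simp [h] at h'
      rw [this]; simp
    · have : (Finset.univ.filter fun j' => S i j' = true ∧ j' = j) = {j} := by
        ext j'
        simp only [Finset.mem_filter, Finset.mem_univ, true_and, Finset.mem_singleton]
        exact ⟨fun h => h.2, by rintro rfl; exact ⟨h, rfl⟩⟩
      rw [this]; simp
  have hR : ∀ i j, R i j = parity (Finset.univ.filter fun j' => S i j' = true ∧ j' ≤ j) g := by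
    rintro i ⟨k, hk⟩
    induction k with
    | zero =>
      rw [h₀ _ _ rfl, hsing]
      simp only [ne_eq, not_true_eq_false, decide_false, Bool.false_and, Bool.xor_false]
      congr 1
      ext j'
      simp [Fin.ext_iff, Fin.le_def]
    | succ k ih =>
      rw [h₁ i ⟨k, by omega⟩ _ rfl, ih, hsing]
      simp only [ne_eq, Nat.add_eq_zero_iff, one_ne_zero, and_false, not_false_eq_true, decide_true,
        Bool.true_and]
      rw [← parity_union]
      · congr 1
        ext j'
        simp only [Finset.mem_union, Finset.mem_filter, Finset.mem_univ, true_and, Fin.ext_iff,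
          Fin.le_def]
        constructor
        · rintro (⟨h, h'⟩ | ⟨h, h'⟩) <;> exact ⟨h, by omega⟩
        · rintro ⟨h, h'⟩
          rcases Nat.lt_or_ge j'.1 (k + 1) with h'' | h''
          · exact Or.inr ⟨h, by omega⟩
          · exact Or.inl ⟨h, by omega⟩
      · rw [Finset.disjoint_left]
        intro j' h h'
        simp only [Finset.mem_filter, Finset.mem_univ, true_and, Fin.ext_iff, Fin.le_def] at h h'
        omega
  rw [Fintype.prod_prod_type]
  refine Finset.prod_congr rfl fun i _ => ?_
  rw [Finset.prod_eq_single (⟨m - 1, by omega⟩ : Fin m)]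
  · simp only [hR, Bool.false_and, Bool.xor_false]
    rw [if_pos (by omega)]
    congr 2
    ext j'
    simp only [Finset.mem_filter, Finset.mem_univ, true_and, Fin.le_def, and_iff_left_iff_imp]
    intro _
    have := j'.2
    omega
  · intro j _ hj
    rw [if_neg, phase_zero]
    intro h
    have h : j.1 + 1 = m := h
    exact hj (Fin.ext (by simp; omega))
  · simp

end Grid

/-! ### Detecting the Hamming weight -/

/-- The Hamming weight. -/
def weight {n : ℕ} (x : Fin n → Bool) : ℕ := (Finset.univ.filter fun i => x i = true).card

theorem weight_le {n : ℕ} (x : Fin n → Bool) : weight x ≤ n := by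
  have := Finset.card_le_univ (Finset.univ.filter fun i => x i = true)
  rwa [Fintype.card_fin] at this

theorem prod_phase {ι : Type} (s : Finset ι) (θ : ℝ) (f : ι → Bool) :
    ∏ i ∈ s, phase θ (f i) = Complex.exp (θ * Complex.I) ^ (s.filter fun i => f i = true).card := by
  simp only [phase]
  rw [Finset.prod_ite]
  simp

theorem prod_phase_xor {n : ℕ} (θ : ℝ) (x : Fin n → Bool) (c : Bool) :
    ∏ i, phase θ (xor (x i) c) =
      Complex.exp (θ * (if c then n - weight x else weight x : ℝ) * Complex.I) := by
  rw [prod_phase]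
  cases c
  · rw [← Complex.exp_nat_mul]
    congr 1
    simp [weight]
    ring
  · have h : (Finset.univ.filter fun i => (xor (x i) true) = true).card + weight x = n := by
      have := Finset.card_filter_add_card_filter_not (s := (Finset.univ : Finset (Fin n)))
        (fun i => x i = true)
      rw [Finset.card_fin] at this
      rw [weight, add_comm]
      convert this using 3
      ext i
      simp
    have h' : ((Finset.univ.filter fun i => (xor (x i) true) = true).card : ℝ) = n - weight x := by
      have h : _ = ((n : ℕ) : ℝ) := congrArg _ h
      push_cast at h
      linarith
    rw [← Complex.exp_nat_mul, if_pos rfl, ← h']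
    congr 1
    push_cast
    ring

/-- The phase `exp (i π z / 2 ^ j)` is `-1` for some `j < m`, unless `z = 0`. -/
theorem exists_exp_eq_neg_one {m : ℕ} {z : ℤ} (hz : z ≠ 0) (hzm : z.natAbs < 2 ^ m) :
    ∃ j : Fin m, Complex.exp ((Real.pi * z / 2 ^ j.1 : ℝ) * Complex.I) = -1 := by
  -- For the exact power `2 ^ k` that divides `z`, the angle `π z / 2 ^ k` is an odd multiple of
  -- `π`.
  obtain ⟨k, u, hu, hk⟩ := Nat.exists_eq_two_pow_mul_odd (Int.natAbs_ne_zero.2 hz)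
  have hkm : k < m := by
    by_contra! h
    have h1 : 2 ^ m ≤ 2 ^ k := Nat.pow_le_pow_right (by norm_num) h
    have h2 : 2 ^ k ≤ 2 ^ k * u := Nat.le_mul_of_pos_right _ hu.pos
    omega
  refine ⟨⟨k, hkm⟩, ?_⟩
  obtain ⟨v, hv⟩ : ∃ v : ℤ, Odd v ∧ z = 2 ^ k * v := by
    rcases Int.natAbs_eq z with h | h
    · exact ⟨u, by exact_mod_cast hu, by rw [h, hk]; push_cast; ring⟩
    · refine ⟨-u, ?_, by rw [h, hk]; push_cast; ring⟩
      have : Odd (u : ℤ) := by exact_mod_cast hu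
      exact this.neg
  obtain ⟨⟨a, ha⟩, hz'⟩ := hv
  have h1 : ((Real.pi * z / 2 ^ k : ℝ) : ℂ) * Complex.I =
      (a : ℂ) * (2 * Real.pi * Complex.I) + Real.pi * Complex.I := by
    rw [hz', ha]
    push_cast
    field_simp
  rw [h1, Complex.exp_add, Complex.exp_int_mul_two_pi_mul_I, Complex.exp_pi_mul_I, one_mul]

/-- The gate that prepares a qubit in the state `|0⟩ + exp (i γ) |1⟩`. -/
noncomputable def tiltGate (γ : ℝ) : Matrix.unitaryGroup Bool ℂ := phaseGate γ * hadamardGate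

/-- The amplitudes of a qubit that is tilted by `γ`, exposed to the phases `d`, and transformed
back. -/
theorem hadamard_phase_tilt (γ : ℝ) (d : Bool → ℂ) (c : Bool) :
    (hadamardMatrix * (Matrix.diagonal d * (tiltGate γ).1)) c false =
      (1 / 2) * (d false + bsign c * (d true * Complex.exp (γ * Complex.I))) := by
  have h := inv_sqrt_two_mul_self
  have e : (tiltGate γ).1 = Matrix.diagonal (phase γ) * hadamardMatrix := rfl
  rw [e, Matrix.mul_apply, Fintype.sum_bool]
  simp only [Matrix.diagonal_mul, phase_true, phase_false]
  cases c <;> simp only [hadamardMatrix, Matrix.of_apply, Bool.and_false, Bool.and_true,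
    bsign_true, bsign_false, ← h] <;> ring

theorem star_phase (θ : ℝ) (b : Bool) : star (phase θ b) = phase (-θ) b := by
  cases b
  · simp
  · simp only [phase_true, Complex.star_def, ← Complex.exp_conj]
    simp

theorem phase_neg_mul_phase (θ : ℝ) (b : Bool) : phase (-θ) b * phase θ b = 1 := by
  rw [← star_phase, mul_comm, phase_mul_conj]

theorem ket_apply {Q : Type} [DecidableEq Q] [Fintype Q] (x y : Q → Bool) :
    ket y x = if x = y then 1 else 0 := by
  simp [ket]

theorem tens_ket_zero {Q : Type} [Fintype Q] [DecidableEq Q] (W : Q → Matrix Bool Bool ℂ)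
    (x : Q → Bool) : tens W (ket fun _ => false) x = ∏ q, W q (x q) false := by
  rw [tens_eq_single _ _ x fun _ => false]
  · simp [ket_apply]
  · intro z hz
    exact Or.inr (by simp [ket_apply, hz])

/-- The state of the register after a multiplication by `O` between two transformations that are
inverse to each other, if `O` is constant on the intermediate state. -/
theorem tens_conj_ket_zero {Q : Type} [Fintype Q] [DecidableEq Q] (A B : Q → Matrix Bool Bool ℂ)
    (hBA : ∀ q, B q * A q = 1) (O : (Q → Bool) → ℂ) (c : ℂ)
    (hO : ∀ y, O y * (∏ q, A q (y q) false) = c * ∏ q, A q (y q) false) :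
    tens B (fun y => O y * tens A (ket fun _ => false) y) = c • ket fun _ => false := by
  have : (fun y => O y * tens A (ket fun _ => false) y) = c • tens A (ket fun _ => false) := by
    funext y
    simp only [tens_ket_zero, Pi.smul_apply, smul_eq_mul, hO]
  rw [this, tens_smul, tens_tens]
  simp only [hBA, tens_one]

/-! ### The phase flip at the zero string -/

theorem parity_filter_update {m : ℕ} (S g : Fin m → Bool) {j : Fin m} (hj : g j = true) :
    parity (Finset.univ.filter fun i => Function.update S j (!S j) i = true) g =
      !parity (Finset.univ.filter fun i => S i = true) g := by
  have : (Finset.univ.filter fun i => Function.update S j (!S j) i = true) =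
      symmDiff (Finset.univ.filter fun i => S i = true) {j} := by
    ext i
    by_cases h : i = j
    · subst h
      cases hS : S i <;> simp [Finset.mem_symmDiff, hS]
    · simp [Finset.mem_symmDiff, h]
  rw [this, parity_symmDiff, parity_singleton, hj, Bool.xor_true]

/-- Toggling a fixed position `j` with `g j = true` pairs the subsets of odd parity with those of
even parity, so they are half of all subsets. -/
theorem card_parity_eq_true {m : ℕ} (g : Fin (m + 1) → Bool) (hg : ∃ j, g j = true) :
    (Finset.univ.filter fun S : Fin (m + 1) → Bool =>
      parity (Finset.univ.filter fun i => S i = true) g = true).card = 2 ^ m := by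
  obtain ⟨j, hj⟩ := hg
  have h1 : (Finset.univ.filter fun S : Fin (m + 1) → Bool =>
      parity (Finset.univ.filter fun i => S i = true) g = true).card =
      (Finset.univ.filter fun S : Fin (m + 1) → Bool =>
      ¬ parity (Finset.univ.filter fun i => S i = true) g = true).card := by
    refine Finset.card_nbij' (fun S => Function.update S j (!S j))
      (fun S => Function.update S j (!S j)) ?_ ?_ ?_ ?_
    · intro S hS
      simp only [Finset.coe_filter, Finset.mem_univ, true_and, Set.mem_ofPred_eq] at hS ⊢
      rw [parity_filter_update S g hj, hS]
      simp
    · intro S hS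
      simp only [Finset.coe_filter, Finset.mem_univ, true_and, Set.mem_ofPred_eq] at hS ⊢
      rw [parity_filter_update S g hj]
      simpa using hS
    · intro S _
      simp
    · intro S _
      simp
  have h2 := Finset.card_filter_add_card_filter_not
    (s := (Finset.univ : Finset (Fin (m + 1) → Bool)))
    (fun S => parity (Finset.univ.filter fun i => S i = true) g = true)
  rw [Finset.card_univ, Fintype.card_fun, Fintype.card_bool, Fintype.card_fin, pow_succ] at h2
  omega

/-- Reduces the reflection about zero to phases on single parities: for `g ≠ 0` exactly `2 ^ m`
factors `exp (iπ / 2 ^ m)` occur. -/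
theorem prod_phase_parity {m : ℕ} (g : Fin (m + 1) → Bool) :
    ∏ S : Fin (m + 1) → Bool,
      phase (Real.pi / 2 ^ m) (parity (Finset.univ.filter fun i => S i = true) g) =
      if g = fun _ => false then 1 else -1 := by
  split_ifs with hg
  · refine Finset.prod_eq_one fun S _ => ?_
    have : parity (Finset.univ.filter fun i => S i = true) g = false := by
      apply bsign_injective
      rw [bsign_parity, hg]
      simp
    rw [this, phase_false]
  · have hg' : ∃ j, g j = true := by
      by_contra! h
      exact hg (funext fun j => by simpa using h j)
    rw [prod_phase, card_parity_eq_true g hg', ← Complex.exp_nat_mul, ← Complex.exp_pi_mul_I]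
    congr 1
    push_cast
    field_simp

/-! ### The weight-dependent phase flip on the grid -/

namespace Grid

variable {n m b : ℕ}

theorem realizes_single_aux (hn : 0 < n) (hQ : Fintype.card (Fin n × Fin (4 * m + 1)) ≤ 2 ^ b)
    (W : Fin m → Matrix.unitaryGroup Bool ℂ) :
    Realizes (gridGraph n (4 * m + 1)) dataSite (auxSite (m := m) hn) 30 b 1
      fun φ x => tens (fun j => (W j).1) (φ x) := by
  have := realizes_single (G := gridGraph n (4 * m + 1)) dataSite_injective
    (auxSite_injective (m := m) hn) (dataSite_ne_auxSite hn) hQ (show 1 ≤ 30 by norm_num)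
    (fun _ => 1) W
  simpa [tens_one] using this

theorem realizes_single_data (hn : 0 < n) (hQ : Fintype.card (Fin n × Fin (4 * m + 1)) ≤ 2 ^ b)
    (U : Fin n → Matrix.unitaryGroup Bool ℂ) :
    Realizes (gridGraph n (4 * m + 1)) dataSite (auxSite (m := m) hn) 30 b 1
      fun φ x g => tens (fun i => (U i).1) (fun x' => φ x' g) x := by
  have := realizes_single (G := gridGraph n (4 * m + 1)) dataSite_injective
    (auxSite_injective (m := m) hn) (dataSite_ne_auxSite hn) hQ (show 1 ≤ 30 by norm_num)
    U (fun _ => 1)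
  simpa [tens_one] using this

/-- The auxiliary register can be reflected about the zero string. -/
theorem realizes_reflection (hn : 0 < n) (hm : 2 ^ m ≤ n)
    (hQ : Fintype.card (Fin n × Fin (4 * (m + 1) + 1)) ≤ 2 ^ b) :
    Realizes (gridGraph n (4 * (m + 1) + 1)) dataSite (auxSite (m := m + 1) hn) 30 b 6
      fun φ x g => (if g = fun _ => false then 1 else -1) * φ x g := by
  -- The `2 ^ (m + 1) ≤ 2 n` subsets are distributed over the `n` rows in two batches. Unused places
  -- get the empty set, whose parity contributes no phase.
  have hcard : Fintype.card (Fin (m + 1) → Bool) ≤ Fintype.card (Fin n × Bool) := by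
    simp [pow_succ]
    omega
  obtain ⟨e⟩ := Function.Embedding.nonempty_of_card_le hcard
  let S : Bool → Fin n → Fin (m + 1) → Bool := fun c i =>
    Function.extend e id (fun _ _ => false) (i, c)
  have h := (realizes_parity_phases hn (Nat.succ_pos m) hQ (S false) (Real.pi / 2 ^ m)).comp
    (realizes_parity_phases hn (Nat.succ_pos m) hQ (S true) (Real.pi / 2 ^ m))
  refine cast (congrArg (Realizes _ _ _ _ _ _) ?_) h
  funext φ x g
  rw [← prod_phase_parity, ← mul_assoc]
  congr 1
  have : ∏ S : Fin (m + 1) → Bool,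
      phase (Real.pi / 2 ^ m) (parity (Finset.univ.filter fun i => S i = true) g) =
      ∏ p : Fin n × Bool, phase (Real.pi / 2 ^ m)
        (parity (Finset.univ.filter fun j => S p.2 p.1 j = true) g) := by
    refine Fintype.prod_of_injective e e.injective _ _ ?_ ?_
    · intro p hp
      have : S p.2 p.1 = fun _ => false := Function.extend_apply' _ _ _ hp
      simp [this]
    · intro T
      have : S (e T).2 (e T).1 = T := e.injective.extend_apply _ _ _
      rw [this]
  rw [this, Fintype.prod_prod_type_right, Fintype.prod_bool]

/-- The phase flip of the data register at the strings that do not have weight `t`. -/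
theorem realizes_weight (hn : 0 < n) (hm : 2 ^ m ≤ n) (hm' : n < 2 ^ (m + 1))
    (hQ : Fintype.card (Fin n × Fin (4 * (m + 1) + 1)) ≤ 2 ^ b) (t : ℕ) (ht : t ≤ n) :
    ∃ T, Realizes (gridGraph n (4 * (m + 1) + 1)) dataSite (auxSite (m := m + 1) hn) 30 b 16 T ∧
      ∀ f : QState (Fin n), T (fun x g => f x * ket (fun _ => false) g) =
        fun x g => ((if weight x = t then 1 else -1) * f x) * ket (fun _ => false) g := by
  -- The data bits give auxiliary qubit `j` the relative phase `β j * (n - 2 |x|)`; `γ j` removes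
  -- the term with `n` and shifts by `t`, leaving `π (|x| - t) / 2 ^ j`.
  let β : Fin (m + 1) → ℝ := fun j => -(Real.pi / 2 ^ (j.1 + 1))
  let γ : Fin (m + 1) → ℝ := fun j => Real.pi * n / 2 ^ (j.1 + 1) - Real.pi * t / 2 ^ j.1
  let d : (Fin n → Bool) → Fin (m + 1) → Bool → ℂ := fun x j c => ∏ i, phase (β j) (xor (x i) c)
  let d' : (Fin n → Bool) → Fin (m + 1) → Bool → ℂ := fun x j c => ∏ i, phase (-β j) (xor (x i) c)
  -- The number of rounds is `1 + 3 + 1 + 6 + 1 + (3 + 1) = 16`.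
  have h := (((((realizes_single_aux hn hQ fun j => tiltGate (γ j)).comp
    (realizes_xor_phases hn hQ β)).comp (realizes_single_aux hn hQ fun _ => hadamardGate)).comp
    (realizes_reflection hn hm hQ)).comp (realizes_single_aux hn hQ fun _ => hadamardGate)).comp
    ((realizes_xor_phases hn hQ fun j => -β j).comp
      (realizes_single_aux hn hQ fun j => star (tiltGate (γ j))))
  refine ⟨_, h, fun f => ?_⟩
  funext x
  have hsmul : (fun g : Fin (m + 1) → Bool => f x * ket (fun _ => false) g) =
      f x • ket fun _ => false := rfl
  have hd : ∀ ψ : QState (Fin (m + 1)), (fun g => (∏ j, ∏ i, phase (β j) (xor (x i) (g j))) * ψ g) =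
      tens (fun j => Matrix.diagonal (d x j)) ψ := fun ψ => (tens_diagonal (d x) ψ).symm
  have hd' : ∀ ψ : QState (Fin (m + 1)),
      (fun g => (∏ j, ∏ i, phase (-β j) (xor (x i) (g j))) * ψ g) =
      tens (fun j => Matrix.diagonal (d' x j)) ψ := fun ψ => (tens_diagonal (d' x) ψ).symm
  let A : Fin (m + 1) → Matrix Bool Bool ℂ := fun j =>
    hadamardMatrix * (Matrix.diagonal (d x j) * (tiltGate (γ j)).1)
  let B : Fin (m + 1) → Matrix Bool Bool ℂ := fun j =>
    star (tiltGate (γ j)).1 * (Matrix.diagonal (d' x j) * hadamardMatrix)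
  let O : (Fin (m + 1) → Bool) → ℂ := fun g => if g = fun _ => false then 1 else -1
  have hdd : ∀ j, Matrix.diagonal (d' x j) * Matrix.diagonal (d x j) = 1 := fun j => by
    rw [Matrix.diagonal_mul_diagonal]
    simp only [d, d', ← Finset.prod_mul_distrib, phase_neg_mul_phase, Finset.prod_const_one]
    exact Matrix.diagonal_one
  have hBA : ∀ j, B j * A j = 1 := fun j => by
    have h1 : star (tiltGate (γ j)).1 * (tiltGate (γ j)).1 = 1 :=
      Matrix.mem_unitaryGroup_iff'.1 (tiltGate (γ j)).2
    calc B j * A j = star (tiltGate (γ j)).1 * (Matrix.diagonal (d' x j) *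
          ((hadamardMatrix * hadamardMatrix) * (Matrix.diagonal (d x j) * (tiltGate (γ j)).1))) := by
          simp only [A, B, Matrix.mul_assoc]
      _ = star (tiltGate (γ j)).1 * ((Matrix.diagonal (d' x j) * Matrix.diagonal (d x j)) *
          (tiltGate (γ j)).1) := by
          rw [hadamardMatrix_mul_self, Matrix.one_mul]
          simp only [Matrix.mul_assoc]
      _ = 1 := by rw [hdd, Matrix.one_mul, h1]
  have hratio : ∀ j : Fin (m + 1), d x j true * Complex.exp (γ j * Complex.I) =
      d x j false * Complex.exp ((Real.pi * ((weight x - t : ℤ) : ℝ) / 2 ^ j.1 : ℝ) * Complex.I) := by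
    intro j
    simp only [d, prod_phase_xor, ← Complex.exp_add, β, γ]
    congr 1
    push_cast
    field_simp
    ring
  -- At weight `t` the register is supported on the zero string. At any other weight its amplitude
  -- there vanishes, as `|weight x - t| ≤ n < 2 ^ (m + 1)` gives some qubit the phase `-1`. In both
  -- cases `O` acts as a scalar.
  have hO : ∀ y, O y * (∏ j, A j (y j) false) =
      (if weight x = t then 1 else -1) * ∏ j, A j (y j) false := by
    intro y
    simp only [O, A, hadamard_phase_tilt, hratio]
    by_cases hw : weight x = t
    · rw [if_pos hw]
      by_cases hy : y = fun _ => false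
      · rw [if_pos hy]
      · have hy' : ∃ j, y j = true := by
          by_contra! h
          exact hy (funext fun j => by simpa using h j)
        obtain ⟨j, hj⟩ := hy'
        rw [Finset.prod_eq_zero (Finset.mem_univ j)]
        · simp
        · simp [hj, hw]
    · rw [if_neg hw]
      by_cases hy : y = fun _ => false
      · have hz : ((weight x : ℤ) - t) ≠ 0 := sub_ne_zero.2 (by exact_mod_cast hw)
        have hz' : ((weight x : ℤ) - t).natAbs < 2 ^ (m + 1) := by
          have := weight_le x
          omega
        obtain ⟨j, hj⟩ := exists_exp_eq_neg_one hz hz'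
        rw [Finset.prod_eq_zero (Finset.mem_univ j)]
        · simp
        · rw [hj, hy]
          simp
      · rw [if_neg hy]
  have key := tens_conj_ket_zero A B hBA O _ hO
  simp only [A, B, ← Matrix.mul_assoc] at key
  have hO' : ∀ (c : ℂ) (ψ : QState (Fin (m + 1))),
      (fun g => O g * (c • ψ) g) = c • fun g => O g * ψ g := by
    intro c ψ
    funext g
    simp only [Pi.smul_apply, smul_eq_mul]
    ring
  change tens (fun j => star (tiltGate (γ j)).1)
    (fun g => (∏ j, ∏ i, phase (-β j) (xor (x i) (g j))) * tens (fun _ => hadamardMatrix)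
      (fun g => O g * tens (fun _ => hadamardMatrix) (fun g =>
        (∏ j, ∏ i, phase (β j) (xor (x i) (g j))) * tens (fun j => (tiltGate (γ j)).1)
          (fun g => f x * ket (fun _ => false) g) g) g) g) = _
  rw [hd, hd', hsmul, tens_smul, tens_smul, tens_smul, hO', tens_smul, tens_smul, tens_smul,
    tens_tens, tens_tens, tens_tens, tens_tens, key]
  funext g
  simp only [Pi.smul_apply, smul_eq_mul]
  ring

end Grid

/-! ### Amplitude amplification -/

/-- Intermediate value theorem on `[0, 1/(2n)]`: at the right end the value is `(1 - 1/(2n))^(n-1) /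
2`, which is at least `1/4` by Bernoulli's inequality. -/
theorem exists_prob {n : ℕ} (hn : 1 ≤ n) :
    ∃ p : ℝ, 0 ≤ p ∧ p ≤ 1 ∧ n * (p * (1 - p) ^ (n - 1)) = 1 / 4 := by
  have hn' : (1 : ℝ) ≤ n := by exact_mod_cast hn
  have hcont : ContinuousOn (fun p : ℝ => n * (p * (1 - p) ^ (n - 1)))
      (Set.Icc 0 (1 / (2 * n))) := by
    fun_prop
  have hpos : (0 : ℝ) ≤ 1 / (2 * n) := by positivity
  have hle : (1 : ℝ) / (2 * n) ≤ 1 / 2 := by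
    rw [div_le_div_iff₀ (by positivity) (by norm_num)]
    linarith
  have hbern := one_add_mul_le_pow (a := -(1 / (2 * n) : ℝ)) (by linarith) (n - 1)
  have hval : (1 : ℝ) / 4 ≤ n * (1 / (2 * n) * (1 - 1 / (2 * n)) ^ (n - 1)) := by
    have h1 : (1 : ℝ) / 2 ≤ (1 - 1 / (2 * n)) ^ (n - 1) := by
      rw [sub_eq_add_neg]
      refine le_trans ?_ hbern
      have h2 : ((n - 1 : ℕ) : ℝ) * (1 / (2 * n)) ≤ 1 / 2 := by
        rw [mul_one_div, div_le_div_iff₀ (by positivity) (by norm_num)]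
        have : ((n - 1 : ℕ) : ℝ) ≤ n := by exact_mod_cast Nat.sub_le n 1
        linarith
      rw [mul_neg]
      linarith
    have h3 : (n : ℝ) * (1 / (2 * n) * (1 - 1 / (2 * n)) ^ (n - 1)) =
        1 / 2 * (1 - 1 / (2 * n)) ^ (n - 1) := by
      field_simp
    rw [h3]
    linarith
  obtain ⟨p, hp, hp'⟩ := intermediate_value_Icc hpos hcont (show (1 / 4 : ℝ) ∈ _ from
    ⟨by norm_num, hval⟩)
  exact ⟨p, hp.1, hp.2.trans (hle.trans (by norm_num)), hp'⟩

/-- The square roots of the probabilities `1 - p` and `p`. -/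
noncomputable def amp (p : ℝ) (b : Bool) : ℝ := if b then Real.sqrt p else Real.sqrt (1 - p)

theorem amp_mul_self {p : ℝ} (h₀ : 0 ≤ p) (h₁ : p ≤ 1) (b : Bool) :
    amp p b * amp p b = if b then p else 1 - p := by
  cases b
  · simp [amp, Real.mul_self_sqrt (sub_nonneg.2 h₁)]
  · simp [amp, Real.mul_self_sqrt h₀]

/-- The rotation that maps `|0⟩` to `√(1 - p) |0⟩ + √p |1⟩`. -/
noncomputable def rotationMatrix (p : ℝ) : Matrix Bool Bool ℂ :=
  Matrix.of fun a b =>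
    if b then (if a then (amp p false : ℂ) else -(amp p true : ℂ)) else (amp p a : ℂ)

theorem exists_rotation {p : ℝ} (h₀ : 0 ≤ p) (h₁ : p ≤ 1) :
    ∃ U : Matrix.unitaryGroup Bool ℂ, ∀ a, U.1 a false = amp p a := by
  have hf : (amp p false : ℂ) * amp p false = 1 - p := by
    exact_mod_cast congrArg (Complex.ofReal) (amp_mul_self h₀ h₁ false)
  have ht : (amp p true : ℂ) * amp p true = p := by
    exact_mod_cast congrArg (Complex.ofReal) (amp_mul_self h₀ h₁ true)
  refine ⟨⟨rotationMatrix p, Matrix.mem_unitaryGroup_iff.2 ?_⟩, fun a => by simp [rotationMatrix]⟩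
  ext a b
  rw [Matrix.mul_apply, Fintype.sum_bool]
  cases a <;> cases b <;> simp [rotationMatrix, Matrix.star_apply, hf, ht] <;> ring

theorem weight_eq_zero_iff {n : ℕ} (x : Fin n → Bool) : weight x = 0 ↔ x = fun _ => false := by
  rw [weight, Finset.card_eq_zero, Finset.filter_eq_empty_iff]
  constructor
  · intro h
    funext i
    simpa using h (Finset.mem_univ i)
  · rintro rfl
    simp

theorem weight_eq_one_iff {n : ℕ} (x : Fin n → Bool) :
    weight x = 1 ↔ ∃ i, (fun j => decide (j = i)) = x := by
  rw [weight, Finset.card_eq_one]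
  refine exists_congr fun i => ⟨fun h => ?_, ?_⟩
  · funext j
    have := Finset.ext_iff.1 h j
    simp only [Finset.mem_filter, Finset.mem_univ, true_and, Finset.mem_singleton] at this
    rw [Bool.eq_iff_iff, this, decide_eq_true_iff]
  · rintro rfl
    ext j
    simp

theorem unitString_injective {n : ℕ} :
    Function.Injective fun (i j : Fin n) => decide (j = i) := by
  intro i i' h
  have := congrFun h i
  simpa using this

theorem prod_unitString {n : ℕ} {M : Type} [CommMonoid M] (v : Bool → M) (i : Fin n) :
    ∏ j, v (decide (j = i)) = v true * v false ^ (n - 1) := by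
  rw [← Finset.mul_prod_erase _ _ (Finset.mem_univ i)]
  congr 1
  · simp
  · rw [Finset.prod_congr rfl (g := fun _ => v false)]
    · simp
    · intro j hj
      simp [Finset.ne_of_mem_erase hj]

theorem wState_apply {n : ℕ} (x : Fin n → Bool) :
    wState n x = ((1 / Real.sqrt n : ℝ) : ℂ) * if weight x = 1 then 1 else 0 := by
  simp only [wState, Pi.smul_apply, Finset.sum_apply, smul_eq_mul, ket_apply]
  congr 1
  split_ifs with h
  · obtain ⟨i, rfl⟩ := (weight_eq_one_iff x).1 h
    rw [Finset.sum_eq_single i]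
    · simp
    · intro i' _ hi
      rw [if_neg fun h => hi (unitString_injective h).symm]
    · simp
  · refine Finset.sum_eq_zero fun i _ => if_neg fun hx => h ((weight_eq_one_iff x).2 ⟨i, hx.symm⟩)

/-- One step of amplitude amplification from the success probability `1 / 4`. -/
theorem amplify {n : ℕ} (hn : 1 ≤ n) {p : ℝ} (h₀ : 0 ≤ p) (h₁ : p ≤ 1)
    (hp : n * (p * (1 - p) ^ (n - 1)) = 1 / 4) (U : Matrix.unitaryGroup Bool ℂ)
    (hU : ∀ a, U.1 a false = amp p a) :
    ∃ c : ℂ, tens (fun _ => U.1) (fun x => (if weight x = 0 then 1 else -1) *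
      tens (fun _ => star U.1) (fun x => (if weight x = 1 then 1 else -1) *
        tens (fun _ => U.1) (ket fun _ : Fin n => false) x) x) = c • wState n := by
  set s : QState (Fin n) := tens (fun _ => U.1) (ket fun _ => false) with hs
  set f : QState (Fin n) := fun x => (if weight x = 1 then 1 else -1) * s x with hf
  have hs' : ∀ x, s x = ∏ i, (amp p (x i) : ℂ) := fun x => by
    simp only [hs, tens_ket_zero, hU]
  have hsq : ∀ x, s x * s x = ∏ i, ((if x i then p else 1 - p : ℝ) : ℂ) := fun x => by
    rw [hs', ← Finset.prod_mul_distrib]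
    refine Finset.prod_congr rfl fun i _ => ?_
    rw [← amp_mul_self h₀ h₁]
    push_cast
    rfl
  have htotal : ∑ x, s x * s x = 1 := by
    simp only [hsq]
    have := Finset.prod_univ_sum (fun _ : Fin n => (Finset.univ : Finset Bool))
      (fun _ b => ((if b then p else 1 - p : ℝ) : ℂ))
    rw [Fintype.piFinset_univ] at this
    rw [← this]
    simp
  have hone : ∑ x, (if weight x = 1 then 1 else 0) * (s x * s x) = 1 / 4 := by
    rw [← Fintype.sum_of_injective (fun (i j : Fin n) => decide (j = i)) unitString_injective
      (fun _ => ((p * (1 - p) ^ (n - 1) : ℝ) : ℂ))]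
    · rw [Finset.sum_const, Finset.card_fin, nsmul_eq_mul]
      have := congrArg Complex.ofReal hp
      push_cast at this ⊢
      exact this
    · intro x hx
      rw [if_neg fun h => hx ((weight_eq_one_iff x).1 h), zero_mul]
    · intro i
      rw [if_pos ((weight_eq_one_iff _).2 ⟨i, rfl⟩), hsq,
        prod_unitString (fun b => ((if b then p else 1 - p : ℝ) : ℂ))]
      simp
  -- This is the overlap of `s` and `f`: the weight-one part counts with `+` and the rest with `-`,
  -- so it is `2 · 1/4 - 1`.
  have hzero : tens (fun _ => star U.1) f (fun _ => false) = -(1 / 2) := by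
    have h1 : ∀ y : Fin n → Bool, (∏ i, (star U.1) false (y i)) = s y := fun y => by
      rw [hs']
      refine Finset.prod_congr rfl fun i _ => ?_
      rw [Matrix.star_apply, hU]
      simp
    simp only [tens, h1, hf]
    have h2 : ∀ y, s y * ((if weight y = 1 then 1 else -1) * s y) =
        2 * ((if weight y = 1 then 1 else 0) * (s y * s y)) - s y * s y := fun y => by
      split_ifs <;> ring
    simp only [h2]
    rw [Finset.sum_sub_distrib, ← Finset.mul_sum, hone, htotal]
    norm_num
  -- The reflection negates the state and adds twice its component `-1/2` at zero. Applying `U` then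
  -- yields `-f - s`, which is `-2 s` at weight one and zero elsewhere.
  have hrefl : (fun x => (if weight x = 0 then 1 else -1) * tens (fun _ => star U.1) f x) =
      (-1 : ℂ) • tens (fun _ => star U.1) f + (-1 : ℂ) • ket fun _ => false := by
    funext x
    simp only [Pi.add_apply, Pi.smul_apply, smul_eq_mul, ket_apply, weight_eq_zero_iff]
    split_ifs with h
    · rw [h, hzero]; norm_num
    · simp
  have hadd : ∀ φ φ' : QState (Fin n), tens (fun _ => U.1) (φ + φ') =
      tens (fun _ => U.1) φ + tens (fun _ => U.1) φ' := fun φ φ' => by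
    funext x
    simp only [tens, Pi.add_apply, mul_add, Finset.sum_add_distrib]
  have hUU : U.1 * star U.1 = 1 := Matrix.mem_unitaryGroup_iff.1 U.2
  rw [hrefl, hadd, tens_smul, tens_smul, tens_tens]
  simp only [hUU, tens_one]
  -- At weight one, `s` has the amplitude `√p √(1-p)^(n-1)`; the factor `√n` undoes the
  -- normalization of `wState`.
  refine ⟨((-2 * Real.sqrt n * (amp p true * amp p false ^ (n - 1)) : ℝ) : ℂ), ?_⟩
  funext x
  simp only [Pi.add_apply, Pi.smul_apply, smul_eq_mul, wState_apply, hf, ← hs]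
  split_ifs with h
  · obtain ⟨i, rfl⟩ := (weight_eq_one_iff x).1 h
    rw [hs', prod_unitString (fun b => (amp p b : ℂ))]
    have hsn : ((Real.sqrt n : ℝ) : ℂ) ≠ 0 := by
      rw [Complex.ofReal_ne_zero, Real.sqrt_ne_zero']
      exact_mod_cast hn
    push_cast
    field_simp
    ring
  · ring

/-! ### The circuit for fixed `n` -/

namespace Grid

/-- The five operations of `amplify` take `1 + 16 + 1 + 16 + 1 = 35` rounds. Each weight flip
returns the auxiliary register to zero, so the next one can reuse it. -/
theorem exists_circuit {n m b : ℕ} (hn : 1 ≤ n) (hm : 2 ^ m ≤ n) (hm' : n < 2 ^ (m + 1))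
    (hQ : Fintype.card (Fin n × Fin (4 * (m + 1) + 1)) ≤ 2 ^ b) :
    ∃ A : HybridCircuit (gridGraph n (4 * (m + 1) + 1)), HybridCircuit.Bounded 35 30 b A ∧
      A.Prepares ⟨dataSite, dataSite_injective⟩ (wState n) := by
  obtain ⟨p, h₀, h₁, hp⟩ := exists_prob hn
  obtain ⟨U, hU⟩ := exists_rotation h₀ h₁
  obtain ⟨T₁, hT₁, hT₁'⟩ := realizes_weight (b := b) hn hm hm' hQ 1 hn
  obtain ⟨T₀, hT₀, hT₀'⟩ := realizes_weight (b := b) hn hm hm' hQ 0 (Nat.zero_le n)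
  obtain ⟨-, A, hA, h⟩ := ((((realizes_single_data hn hQ fun _ => U).comp hT₁).comp
    (realizes_single_data hn hQ fun _ => star U)).comp hT₀).comp
    (realizes_single_data hn hQ fun _ => U)
  refine ⟨A, hA, fun χ hχ => ?_⟩
  have hstart : (ket fun _ => false : QState (Fin n × Fin (4 * (m + 1) + 1))) =
      registerState dataSite (auxSite (m := m + 1) hn)
        fun x g => ket (fun _ => false) x * ket (fun _ => false) g := by
    funext z
    simp only [registerState, ket_apply]
    by_cases hz : z = fun _ => false
    · simp [hz]
    · rw [if_neg hz]
      split_ifs with h1 h2 h3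
      · refine absurd (funext fun q => ?_) hz
        by_cases hx : q ∈ Set.range (dataSite (n := n) (m := m + 1))
        · obtain ⟨i, rfl⟩ := hx
          exact congrFun h2 i
        · by_cases hy : q ∈ Set.range (auxSite (m := m + 1) hn)
          · obtain ⟨j, rfl⟩ := hy
            exact congrFun h3 j
          · exact h1 q hx hy
      all_goals simp
  rw [hstart] at hχ
  obtain ⟨c, rfl⟩ := h _ _ _ hχ
  have hdata : ∀ (W : Matrix Bool Bool ℂ) (f : QState (Fin n)),
      (fun (x : Fin n → Bool) (g : Fin (m + 1) → Bool) =>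
        tens (fun _ => W) (fun x' => f x' * ket (fun _ => false) g) x) =
      fun x g => tens (fun _ => W) f x * ket (fun _ => false) g := by
    intro W f
    funext x g
    simp only [tens, ← mul_assoc, Finset.sum_mul]
  obtain ⟨k, hk⟩ := amplify hn h₀ h₁ hp U hU
  refine ⟨c * k, ?_⟩
  rw [mul_smul]
  congr 1
  change registerState _ _ (fun x g => tens (fun _ => U.1) (fun x' => T₀ (fun x g =>
    tens (fun _ => star U.1) (fun x' => T₁ (fun x g => tens (fun _ => U.1)
      (fun x' => ket (fun _ => false) x' * ket (fun _ => false) g) x) x' g) x) x' g) x) = _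
  rw [hdata, hT₁', hdata, hT₀', hdata, hk]
  funext z
  simp only [registerState, HybridCircuit.embedState, Pi.smul_apply, smul_eq_mul, ket_apply,
    Function.Embedding.coeFn_mk]
  by_cases hz : ∀ q, q ∉ Set.range (dataSite (n := n) (m := m + 1)) → z q = false
  · have haux : (fun j => z (auxSite (m := m + 1) hn j)) = fun _ => false := funext fun j =>
      hz _ fun ⟨i, hi⟩ => dataSite_ne_auxSite hn i j hi
    rw [if_pos fun q hq _ => hz q hq, if_pos haux, if_pos hz, mul_one]
    rfl
  · rw [if_neg (c := ∀ q, q ∉ Set.range _ → z q = false) hz, mul_zero]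
    split_ifs with h1 h2
    · refine absurd (fun q hq => ?_) hz
      by_cases hy : q ∈ Set.range (auxSite (m := m + 1) hn)
      · obtain ⟨j, rfl⟩ := hy
        exact congrFun h2 j
      · exact h1 q hq hy
    · simp
    · rfl

end Grid

/-! ### The family of circuits -/

/-- The number of columns. -/
def gridWidth (n : ℕ) : ℕ := 4 * (Nat.log 2 n + 1) + 1

theorem card_grid_le (n : ℕ) :
    Fintype.card (Fin n × Fin (gridWidth n)) ≤ 2 ^ (4 * (Nat.log 2 n + 1)) := by
  rw [Fintype.card_prod, Fintype.card_fin, Fintype.card_fin, gridWidth]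
  have h1 : n ≤ 2 ^ (Nat.log 2 n + 1) := (Nat.lt_pow_succ_log_self (by norm_num) n).le
  generalize Nat.log 2 n + 1 = L at *
  have h2 : L < 2 ^ L := Nat.lt_two_pow_self
  have h3 : 4 * L + 1 ≤ 2 ^ (3 * L) := by
    rcases L with _ | L
    · norm_num
    · have h4 : 4 * (L + 1) + 1 ≤ 2 ^ 2 * 2 ^ (L + 1) := by omega
      calc 4 * (L + 1) + 1 ≤ 2 ^ 2 * 2 ^ (L + 1) := h4
        _ = 2 ^ (2 + (L + 1)) := (pow_add _ _ _).symm
        _ ≤ 2 ^ (3 * (L + 1)) := Nat.pow_le_pow_right (by norm_num) (by omega)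
  calc n * (4 * L + 1) ≤ 2 ^ L * 2 ^ (3 * L) := Nat.mul_le_mul h1 h3
    _ = 2 ^ (4 * L) := by rw [← pow_add]; congr 1; ring

/-- The case `n = 0` gets the empty circuit, since the size bound `(n + 1) ^ c` equals one there for
every `c`. -/
theorem exists_wState_circuit (n : ℕ) : ∃ A : HybridCircuit (gridGraph n (gridWidth n)),
    HybridCircuit.Bounded 35 30 (4 * (Nat.log 2 n + 1)) A ∧ (n = 0 → A = []) ∧
    (1 ≤ n → ∃ out : Fin n ↪ Fin n × Fin (gridWidth n), A.Prepares out (wState n)) := by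
  rcases Nat.eq_zero_or_pos n with rfl | hn
  · exact ⟨[], ⟨by simp, by simp, by simp, by simp⟩, fun _ => rfl, fun h => absurd h (by norm_num)⟩
  · obtain ⟨A, hA, hA'⟩ := Grid.exists_circuit hn (Nat.pow_log_le_self 2 hn.ne')
      (Nat.lt_pow_succ_log_self (by norm_num) n) (card_grid_le n)
    exact ⟨A, hA, fun h => absurd h hn.ne', fun _ => ⟨_, hA'⟩⟩

theorem two_pow_log_succ_le {n : ℕ} (hn : n ≠ 0) : 2 ^ (Nat.log 2 n + 1) ≤ (n + 1) ^ 2 := by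
  have := Nat.pow_log_le_self 2 hn
  rw [pow_succ]
  nlinarith

theorem gridWidth_isBigO : (fun n : ℕ => (gridWidth n : ℝ)) =O[atTop]
    fun n : ℕ => Real.log n * Real.log (Real.log n) := by
  have hlog : Tendsto (fun n : ℕ => Real.log (n : ℝ)) atTop atTop :=
    Real.tendsto_log_atTop.comp tendsto_natCast_atTop_atTop
  have hloglog : Tendsto (fun n : ℕ => Real.log (Real.log (n : ℝ))) atTop atTop :=
    Real.tendsto_log_atTop.comp hlog
  -- From `Nat.log 2 n ≤ 2 log n` the width is at most `8 log n + 5 ≤ 13 log n` once `log n ≥ 1`;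
  -- the factor `log log n` only has to be at least one.
  refine IsBigO.of_bound 13 ?_
  filter_upwards [hlog.eventually_ge_atTop 1, hloglog.eventually_ge_atTop 1,
    eventually_ge_atTop 1] with n h1 h2 hn
  have h3 : (Nat.log 2 n : ℝ) ≤ 2 * Real.log n := by
    have h4 : (2 : ℝ) ^ Nat.log 2 n ≤ n := by exact_mod_cast Nat.pow_log_le_self 2 (by omega)
    have h5 := Real.log_le_log (by positivity) h4
    rw [Real.log_pow] at h5
    have h6 : (1 : ℝ) / 2 ≤ Real.log 2 := by have := Real.log_two_gt_d9; linarith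
    have h7 : (0 : ℝ) ≤ Nat.log 2 n := by positivity
    nlinarith
  have h8 : (gridWidth n : ℝ) ≤ 13 * Real.log n := by
    simp only [gridWidth]
    push_cast
    linarith
  rw [Real.norm_of_nonneg (by positivity), Real.norm_of_nonneg (by nlinarith)]
  nlinarith

theorem theorem7p3p1 :
    ∃ (w : ℕ → ℕ) (A : (n : ℕ) → HybridCircuit (gridGraph n (w n))),
      IsLAQCC A ∧
      (∀ n : ℕ, 1 ≤ n → ∃ out : Fin n ↪ Fin n × Fin (w n), (A n).Prepares out (wState n)) ∧
      (fun n : ℕ => (w n : ℝ)) =O[atTop]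
        (fun n : ℕ => Real.log n * Real.log (Real.log n)) ∧
      (fun n : ℕ => (Fintype.card (Fin n × Fin (w n)) : ℝ)) =O[atTop]
        (fun n : ℕ => (n : ℝ) * Real.log n * Real.log (Real.log n)) := by
  choose A hA hA₀ hA' using exists_wState_circuit
  -- With `b = 4 L` and `L = Nat.log 2 n + 1`, the formula depth `3 b` is `12 L`. The size `2 ^ (4 b
  -- + 1)` is at most `(2 ^ L) ^ 17`, and `2 ^ L ≤ (n + 1) ^ 2` gives the exponent 34.
  refine ⟨gridWidth, A, ⟨⟨35, fun n => (hA n).length_le⟩, ⟨30, fun n => (hA n).quantum_le⟩,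
    ⟨12, fun n R hR i => ((hA n).depth_le R hR i).trans (by omega)⟩, ⟨34, fun n R hR => ?_⟩⟩, hA',
    gridWidth_isBigO, ?_⟩
  · rcases Nat.eq_zero_or_pos n with rfl | hn
    · rw [hA₀ 0 rfl] at hR
      simp at hR
    · calc ∑ i, (R.classical i).size ≤ 2 ^ (4 * (4 * (Nat.log 2 n + 1)) + 1) :=
          (hA n).size_le R hR
        _ ≤ 2 ^ ((Nat.log 2 n + 1) * 17) := Nat.pow_le_pow_right (by norm_num) (by omega)
        _ = (2 ^ (Nat.log 2 n + 1)) ^ 17 := pow_mul _ _ _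
        _ ≤ ((n + 1) ^ 2) ^ 17 := Nat.pow_le_pow_left (two_pow_log_succ_le hn.ne') _
        _ = (n + 1) ^ 34 := by rw [← pow_mul]
  · have h := (isBigO_refl (fun n : ℕ => (n : ℝ)) atTop).mul gridWidth_isBigO
    simpa [mul_assoc] using h
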